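/- **Model.** A network is a finite simple graph $G$ on vertices (agents) $1,\dots,n$ in which every agent numbers its incident edges (ports) and the agents carry pairwise distinct identifiers in $\mathbb N$; the vertex labels are not known to the agents. $G$ is *2-connected* if $n\ge 3$, $G$ is connected, and $G$ stays connected after the removal of any one vertex. Each agent has an input from a finite non-empty set $X$. A *strategy* of an agent is a randomised state machine with an arbitrary state space: the initial state is drawn knowing only the agent's own identifier, degree and input; in each synchronous round the agent sends one message through each of its ports, receives one message through each port and draws its next state; at some time it may irrevocably output a value of a finite set $Y$ or $\bot$. Agents randomise independently. A *protocol* is a strategy $\Lambda$ executed by all agents. A *deviation* of an agent is any strategy of that agent while all other agents run $\Lambda$ (so it may behave on its ports as if it were a whole subgraph of fictitious agents). **Problem.** Let $|Y|=k\ge 2$ and let $q$ assign to each input vector $(x_1,\dots,x_m)\in X^m$, for every $m$, a value in $Y$, such that (full knowledge) for all $m$, all $j\le m$ and all fixed $x_l$ $(l\neq j)$ the number $|\{x_j\in X: q(x_1,\dots,x_m)=y\}|$ is the same for all $y\in Y$. Let $\sigma$ be a probability distribution on $\mathbb N$. A protocol $\Lambda$ *solves Knowledge Sharing* for $q$ and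 $\sigma$ if on every 2-connected network whose size $n$ satisfies $\sigma(n)>0$, and for all inputs, with probability one every agent eventually outputs $q(x_1,\dots,x_n)$. An output vector is *legal* if all agents output the same value, different from $\bot$. The utility $u_a$ of an agent $a$ with preferred value $p\in Y$ is $1$ if the output vector is legal and $a$ outputs $p$, and $0$ otherwise (an agent that never terminates counts as outputting $\bot$). An agent does not know the network or its position in it. It has a prior $B$ over pairs (network, position), and the inputs of the other agents are independent and uniform on $X$. For a strategy $S$ of this agent, $\mathbb E_{S}[u_a\mid i]$ denotes its expected utility under the prior $B$ when its own input is $i$, it behaves according to $S$ and all other agents run $\Lambda$; $\mathbb E_{S}[u_a\mid N,i]$ denotes the same expectation when the network and position are $N$. **Theorem.** Suppose that $\sigma$ has infinite support in the sense that there is $n_0$ with $\sigma(m)>0$ for all $m>n_0$. Let $\Lambda$ be a protocol that solves Knowledge Sharing for $q$ and $\sigma$. Let $p\in Y$, and let $\tau$ be any probability distribution over pairs (2-connected port-numbered graph, position of the agent) whose marginal on the number of vertices is $\sigma$. Then identifiers can be added so that $\Lambda$ is not an equilibrium: there is a prior $B$ over pairs (network, position) whose marginal on pairs (port-numbered graph,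 position) is $\tau$ and under which the agent's own identifier is constant, and there is a strategy $D$ of the agent, such that $$\mathbb E_{D}[u_a\mid i]>\mathbb E_{\Lambda}[u_a\mid i]\qquad\text{for every own input } i\in X ,$$ and moreover there is a network and position $N$ in the support of $B$ with $\mathbb E_{D}[u_a\mid N,i]>\mathbb E_{\Lambda}[u_a\mid N,i]$ for every $i\in X$. In particular, no protocol for Knowledge Sharing is an equilibrium in 2-connected graphs when the agents' prior on $n$ has infinite support. -/

import Mathlib

open scoped ENNReal

noncomputable section

namespace KnowledgeSharing

/-! ### Product of finitely many discrete distributions -/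

theorem tsum_prod_eq_one : ∀ {n : ℕ} {α : Fin n → Type} (P : ∀ i, PMF (α i)),
    ∑' c : (∀ i, α i), ∏ i, P i (c i) = 1
  | 0, α, P => by
      rw [tsum_eq_single (fun i => i.elim0) (fun c hc => (hc (funext fun i => i.elim0)).elim)]
      simp
  | n + 1, α, P => by
      rw [← (Fin.consEquiv α).tsum_eq, ENNReal.tsum_prod']
      simp only [Fin.consEquiv, Equiv.coe_fn_mk, Fin.prod_univ_succ, Fin.cons_zero, Fin.cons_succ]
      simp only [ENNReal.tsum_mul_left, tsum_prod_eq_one (fun i => P i.succ), mul_one]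
      exact (P 0).tsum_coe

/-- The joint law of independent draws, one from each `P i`. -/
def independent {n : ℕ} {α : Fin n → Type} (P : ∀ i, PMF (α i)) : PMF (∀ i, α i) :=
  ⟨fun c => ∏ i, P i (c i), by
    rw [← tsum_prod_eq_one P]; exact ENNReal.summable.hasSum⟩

/-! ### Networks -/

/-- A finite simple graph on the labels `Fin n` in which every vertex `v` has numbered its
`deg v` incident edges. Neither the labels nor the identity of the neighbour behind a port is
known to the agents. -/
structure Topology where
  n : ℕ
  G : SimpleGraph (Fin n)
  deg : Fin n → ℕ
  port : ∀ v, Fin (deg v) ≃ G.neighborSet v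

/-- 2-vertex-connectedness: at least three vertices, connected, and still connected after the
removal of any one vertex. -/
def TwoConnected {n : ℕ} (G : SimpleGraph (Fin n)) : Prop :=
  3 ≤ n ∧ G.Connected ∧ ∀ v : Fin n, (G.induce {v}ᶜ).Connected

/-- A topology together with pairwise distinct identifiers of the agents. -/
structure Network extends Topology where
  ident : Fin n → ℕ
  ident_injective : Function.Injective ident

/-- A topology seen from one agent: the graph and the position of the agent in it. -/
abbrev PointedTopology := Σ T : Topology, Fin T.n

/-- A network seen from one agent: the network and the position of the agent in it. -/
abbrev PointedNetwork := Σ N : Network, Fin N.n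

/-- Forget the identifiers. -/
def PointedNetwork.topology (N : PointedNetwork) : PointedTopology := ⟨N.1.toTopology, N.2⟩

/-! ### Randomised synchronous behaviour of a single agent -/

/-- What one agent does, as a randomised state machine with arbitrary (unbounded) state space.
`X`, `M`, `Y` are the types of inputs, of messages and of output values.
The initial state is drawn knowing only the agent's own identifier, its number of ports and its
input. In every round an agent in state `s` sends `msg s i` through its `i`-th port (only the
`i` below its number of ports matter), receives one message per port, and draws its next state.
`out s` is `none` while the agent has not terminated, `some none` if it has output `⊥`, and
`some (some y)` if it has output `y`; an output is never revised.

A protocol is such a behaviour executed by all agents; a deviation of one agent is an arbitrary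
such behaviour of that agent. Since agents only see messages on ports, a deviation may in
particular act on different ports as different fictitious agents. -/
structure Strategy (X M Y : Type) where
  State : Type
  init : (ident deg : ℕ) → X → PMF State
  msg : State → ℕ → M
  step : State → (deg : ℕ) → (Fin deg → M) → PMF State
  out : State → Option (Option Y)
  out_step : ∀ s deg r o, out s = some o → ∀ s' ∈ (step s deg r).support, out s' = some o

/-! ### Executions -/

section Execution

variable {X M Y : Type} (N : Network) (prof : Fin N.n → Strategy X M Y)

/-- A global configuration: the state of every agent. -/
abbrev Config := ∀ v, (prof v).State

variable {prof} in
/-- The message that reaches `v` through its port `i`: the one that the neighbour behind this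
port sends through its own port to `v`. -/
def received (c : Config N prof) (v : Fin N.n) (i : Fin (N.deg v)) : M :=
  let w := N.port v i
  (prof w).msg (c w) ((N.port w).symm ⟨v, SimpleGraph.Adj.symm w.2⟩ : Fin (N.deg w))

/-- The law of the configuration after `t` rounds, for the inputs `x`. -/
def configLaw (x : Fin N.n → X) : ℕ → PMF (Config N prof)
  | 0 => independent fun v => (prof v).init (N.ident v) (N.deg v) (x v)
  | t + 1 => (configLaw x t).bind fun c =>
      independent fun v => (prof v).step (c v) (N.deg v) (received N c v)

variable {prof} in
/-- The output vector in a configuration; `none` stands for `⊥`, which is also the entry of an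
agent that has not terminated. -/
def outputs (c : Config N prof) (v : Fin N.n) : Option Y := ((prof v).out (c v)).join

end Execution

/-! ### The problem -/

/-- Legal output vectors: all agents output the same value, which is not `⊥`. -/
def Legal {n : ℕ} {Y : Type} (O : Fin n → Option Y) : Prop :=
  ∀ a b, O a = O b ∧ O a ≠ none

open Classical in
/-- The utility of agent `a` with preferred value `p`. -/
def utility {n : ℕ} {Y : Type} (a : Fin n) (p : Y) (O : Fin n → Option Y) : ℝ≥0∞ :=
  if O a = some p ∧ Legal O then 1 else 0

/-- The full knowledge property of a function `q` with output space `Y`, defined on input vectors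
of every length: when all inputs but the `j`-th are fixed, every output value is attained for
the same number of values of the `j`-th input. -/
def FullKnowledge {X Y : Type} (q : ∀ m : ℕ, (Fin m → X) → Y) : Prop :=
  ∀ (m : ℕ) (j : Fin m) (x : Fin m → X) (y y' : Y),
    Nat.card {z : X // q m (Function.update x j z) = y} =
      Nat.card {z : X // q m (Function.update x j z) = y'}

/-- A prior on the network size has infinite support if all large sizes are possible. -/
def InfiniteSupport (σ : PMF ℕ) : Prop := ∃ n₀ : ℕ, ∀ m > n₀, 0 < σ m

/-- `Λ` is a Knowledge Sharing protocol for `q` and the prior `σ`: on every 2-connected network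
of a possible size and for all inputs, with probability one every agent running `Λ` eventually
outputs the value of `q` at the vector of all inputs. -/
def SolvesKnowledgeSharing {X M Y : Type} (q : ∀ m : ℕ, (Fin m → X) → Y) (σ : PMF ℕ)
    (Λ : Strategy X M Y) : Prop :=
  ∀ N : Network, TwoConnected N.G → N.n ∈ σ.support → ∀ x : Fin N.n → X,
    ⨆ t, (configLaw N (fun _ => Λ) x t).toOuterMeasure
      {c | ∀ v, outputs N c v = some (q N.n x)} = 1

/-! ### Expected utility -/

section Utility

variable {X M Y : Type}

/-- Expected utility of `a` in an execution with inputs `x`. Outputs are never revised, so the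
expectation of the utility of the configuration after `t` rounds increases with `t`; its limit
is the expected utility of the final output vector. -/
def runUtility (N : Network) (prof : Fin N.n → Strategy X M Y) (a : Fin N.n) (p : Y)
    (x : Fin N.n → X) : ℝ≥0∞ :=
  ⨆ t, ∑' c, configLaw N prof x t c * utility a p (outputs N c)

/-- Expected utility, in the network `N`, of the agent at position `N.2` with input `i` and
preferred value `p`, when it behaves according to `S` and all others run `Λ`; the inputs of the
other agents are independent and uniform. -/
def networkUtility [Fintype X] [Nonempty X] (Λ S : Strategy X M Y) (p : Y) (i : X)
    (N : PointedNetwork) : ℝ≥0∞ :=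
  ∑' x : Fin N.1.n → X, PMF.uniformOfFintype (Fin N.1.n → X) x *
    runUtility N.1 (Function.update (fun _ => Λ) N.2 S) N.2 p (Function.update x N.2 i)

/-- Expected utility of behaving according to `S`, as estimated at the start by an agent with
input `i`, preferred value `p` and prior `B` over the network and its own position in it. -/
def expectedUtility [Fintype X] [Nonempty X] (Λ S : Strategy X M Y) (p : Y) (i : X)
    (B : PMF PointedNetwork) : ℝ≥0∞ :=
  ∑' N, B N * networkUtility Λ S p i N

end Utility

end KnowledgeSharing

end

/-! The deviator pretends to be most of a larger network and changes its story at the right moment.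
Fix a degree d that the agent has with positive probability under the prior `τ`, and let `π` be `τ`
conditioned on that degree. Draw two independent halves, each a topology from `π` with uniform
inputs. Remove the distinguished agent from each half and attach the 2d loose ports to a complete
graph on more than n₀ vertices. The result is 2-connected and large enough for `Λ` to be correct on
it (`iSup_allOutput`). Identifiers in different residue classes mod 3 keep the three parts disjoint.
An agent inside a half cannot tell the middle part from one agent of degree d, so that agent may
simulate the middle together with the other half.

In the joined network the result is p with probability θ = 1/k, by full knowledge, and 0 < θ < 1.
Consider the transcript at the cut between one half and the rest. Given the transcript, the states
on the two sides are independent (`Party.law_record_apply`). Hence, when the transcript is c, the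
simulator may jump to any simulated state z compatible with c: the resulting pair of states also
occurs in an honest execution. From there all agents almost surely output the value belonging to the
new data. If a jump makes p more likely than θ, it is a profitable deviation.

Suppose that no jump at either cut is profitable. If the transcript at a cut is uninformative about
the event that the result is p, then every compatible state z gives that event conditional
probability at most θ, while the average over z is θ; so each z gives exactly θ, and the whole state
behind the cut is uninformative (`Party.uninformative_of_no_gain`). That state, at one cut,
determines the transcript of the other cut one round later (`Party.Setting.uninformative_succ`). By
induction over the rounds, run on both cuts together, the middle part never learns anything. Yet its
output must eventually say whether the result is p. The event would be nearly independent of itself,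
forcing θ = θ² (`Party.Setting.not_noGain`).

So one cut admits a profitable jump. The prior gives the agents other than the deviator the
identifiers of the exploited half and gives the deviator the identifier 0. With degree d the
deviator runs the jumping simulation; with any other degree it is honest. Honest utility is θ in
every network of the support, so the average gain over `π` is a gain under the prior and also in
some single network. The simulation ignores the deviator's own input, so the gain holds for every
input. -/

open scoped ENNReal

noncomputable section

namespace KnowledgeSharing

/-! ### Discrete expectations and product laws. -/

section

/-! ### Expectations under discrete distributions -/

section Expectation

variable {α β γ : Type}

/-- The expectation of a nonnegative function. -/
def ex (μ : PMF α) (f : α → ℝ≥0∞) : ℝ≥0∞ := ∑' a, μ a * f a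

open Classical in
/-- The indicator of a proposition. -/
def ind (P : Prop) : ℝ≥0∞ := if P then 1 else 0

theorem ind_of {P : Prop} (h : P) : ind P = 1 := if_pos h

theorem ind_of_not {P : Prop} (h : ¬P) : ind P = 0 := if_neg h

theorem ind_le_one (P : Prop) : ind P ≤ 1 := by unfold ind; split <;> simp

theorem ind_mono {P Q : Prop} (h : P → Q) : ind P ≤ ind Q := by
  by_cases hP : P
  · rw [ind_of hP, ind_of (h hP)]
  · rw [ind_of_not hP]; exact zero_le

theorem ind_congr {P Q : Prop} (h : P ↔ Q) : ind P = ind Q := by rw [propext h]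

theorem ind_and (P Q : Prop) : ind (P ∧ Q) = ind P * ind Q := by
  by_cases hP : P <;> by_cases hQ : Q <;> simp [ind, hP, hQ]

theorem ex_pure (a : α) (f : α → ℝ≥0∞) : ex (PMF.pure a) f = f a := by
  unfold ex
  rw [tsum_eq_single a]
  · simp
  · intro b hb; simp [PMF.pure_apply, hb]

theorem ex_bind (μ : PMF α) (κ : α → PMF β) (f : β → ℝ≥0∞) :
    ex (μ.bind κ) f = ex μ fun a => ex (κ a) f := by
  unfold ex
  simp only [PMF.bind_apply, ← ENNReal.tsum_mul_right, ← ENNReal.tsum_mul_left]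
  rw [ENNReal.tsum_comm]
  simp only [mul_assoc]

theorem ex_map (μ : PMF α) (g : α → β) (f : β → ℝ≥0∞) : ex (μ.map g) f = ex μ fun a => f (g a) := by
  rw [← PMF.bind_pure_comp, ex_bind]
  simp [ex_pure]

theorem ex_const (μ : PMF α) (c : ℝ≥0∞) : ex μ (fun _ => c) = c := by
  unfold ex
  rw [ENNReal.tsum_mul_right, PMF.tsum_coe, one_mul]

theorem ex_mono_support {μ : PMF α} {f g : α → ℝ≥0∞} (h : ∀ a, μ a ≠ 0 → f a ≤ g a) :
    ex μ f ≤ ex μ g := by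
  refine ENNReal.tsum_le_tsum fun a => ?_
  by_cases ha : μ a = 0
  · simp [ha]
  · gcongr; exact h a ha

theorem ex_mono {μ : PMF α} {f g : α → ℝ≥0∞} (h : ∀ a, f a ≤ g a) : ex μ f ≤ ex μ g :=
  ex_mono_support fun a _ => h a

theorem ex_congr_support {μ : PMF α} {f g : α → ℝ≥0∞} (h : ∀ a, μ a ≠ 0 → f a = g a) :
    ex μ f = ex μ g :=
  le_antisymm (ex_mono_support fun a ha => (h a ha).le) (ex_mono_support fun a ha => (h a ha).ge)

theorem ex_add (μ : PMF α) (f g : α → ℝ≥0∞) :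
    ex μ (fun a => f a + g a) = ex μ f + ex μ g := by
  unfold ex
  rw [← ENNReal.tsum_add]
  simp only [mul_add]

theorem ex_le_one {μ : PMF α} {f : α → ℝ≥0∞} (h : ∀ a, f a ≤ 1) : ex μ f ≤ 1 :=
  (ex_mono h).trans (ex_const μ 1).le

/-- Monotone convergence: an infinite sum in `ℝ≥0∞` is a supremum of finite sums, and suprema
commute. -/
theorem ex_iSup {μ : PMF α} {f : ℕ → α → ℝ≥0∞} (h : ∀ a, Monotone fun n => f n a) :
    ex μ (fun a => ⨆ n, f n a) = ⨆ n, ex μ (f n) := by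
  unfold ex
  simp only [ENNReal.mul_iSup, ENNReal.tsum_eq_iSup_sum]
  rw [iSup_comm]
  refine iSup_congr fun s => ?_
  refine ENNReal.finsetSum_iSup_of_monotone fun a m n hmn => ?_
  have := h a hmn
  dsimp at this ⊢
  gcongr

/-- A function bounded by one whose expectation is one equals one on the support. -/
theorem eq_one_of_ex_eq_one {μ : PMF α} {f : α → ℝ≥0∞} (hf : ∀ a, f a ≤ 1) (h : ex μ f = 1)
    {a : α} (ha : μ a ≠ 0) : f a = 1 := by
  by_contra hne
  have hlt : f a < 1 := lt_of_le_of_ne (hf a) hne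
  have : ex μ f < ex μ fun _ => 1 := by
    refine ENNReal.tsum_lt_tsum (i := a) (by unfold ex at h; rw [h]; simp) (fun b => ?_) ?_
    · gcongr; exact hf b
    · exact ENNReal.mul_lt_mul_right ha (PMF.apply_ne_top μ a) hlt
  rw [h, ex_const] at this
  exact lt_irrefl _ this

theorem bind_congr_support {μ : PMF α} {κ κ' : α → PMF β} (h : ∀ a, μ a ≠ 0 → κ a = κ' a) :
    μ.bind κ = μ.bind κ' := by
  ext b
  simp only [PMF.bind_apply]
  refine tsum_congr fun a => ?_
  by_cases ha : μ a = 0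
  · simp [ha]
  · rw [h a ha]

theorem toOuterMeasure_eq_ex (μ : PMF α) (s : Set α) :
    μ.toOuterMeasure s = ex μ fun a => ind (a ∈ s) := by
  rw [PMF.toOuterMeasure_apply]
  refine tsum_congr fun a => ?_
  by_cases h : a ∈ s <;> simp [ind, h]

theorem map_equiv_apply (μ : PMF α) (e : α ≃ β) (b : β) : μ.map e b = μ (e.symm b) := by
  classical
  rw [PMF.map_apply, tsum_eq_single (e.symm b)]
  · simp
  · intro a ha
    rw [if_neg]
    rintro rfl
    simp at ha

end Expectation

/-! ### Product distributions -/

section Product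

variable {α β γ δ : Type}

/-- The law of a pair of independent draws. -/
def pmfProd (μ : PMF α) (ν : PMF β) : PMF (α × β) := μ.bind fun a => ν.map (Prod.mk a)

theorem pmfProd_apply (μ : PMF α) (ν : PMF β) (x : α × β) : pmfProd μ ν x = μ x.1 * ν x.2 := by
  classical
  obtain ⟨a, b⟩ := x
  unfold pmfProd
  rw [PMF.bind_apply, tsum_eq_single a]
  · congr 1
    rw [PMF.map_apply, tsum_eq_single b]
    · simp
    · intro b' hb; rw [if_neg]; simpa using hb.symm
  · intro a' ha
    rw [PMF.map_apply, ENNReal.tsum_eq_zero.2, mul_zero]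
    intro b'
    rw [if_neg]
    simp [ha.symm]

theorem ex_pmfProd (μ : PMF α) (ν : PMF β) (f : α × β → ℝ≥0∞) :
    ex (pmfProd μ ν) f = ex μ fun a => ex ν fun b => f (a, b) := by
  unfold pmfProd
  rw [ex_bind]
  simp only [ex_map]

theorem pmfProd_map (μ : PMF α) (ν : PMF β) (f : α → γ) (g : β → δ) :
    (pmfProd μ ν).map (Prod.map f g) = pmfProd (μ.map f) (ν.map g) := by
  unfold pmfProd
  rw [PMF.map_bind, PMF.bind_map]
  simp only [PMF.map_comp, Function.comp_def, Prod.map_apply]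

/-- The joint law of independent draws indexed by a finite type. -/
def indep {ι : Type} [Fintype ι] {α : ι → Type} (P : ∀ i, PMF (α i)) : PMF (∀ i, α i) :=
  (independent fun k => P ((Fintype.equivFin ι).symm k)).map
    (Equiv.piCongrLeft α (Fintype.equivFin ι).symm)

theorem independent_apply {n : ℕ} {α : Fin n → Type} (P : ∀ i, PMF (α i)) (c : ∀ i, α i) :
    independent P c = ∏ i, P i (c i) := rfl

theorem indep_apply {ι : Type} [Fintype ι] {α : ι → Type} (P : ∀ i, PMF (α i)) (c : ∀ i, α i) :
    indep P c = ∏ i, P i (c i) := by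
  unfold indep
  rw [map_equiv_apply, independent_apply]
  exact Fintype.prod_equiv (Fintype.equivFin ι).symm _ _ fun k => by simp

theorem indep_apply_ne_zero {ι : Type} [Fintype ι] {α : ι → Type} {P : ∀ i, PMF (α i)}
    {c : ∀ i, α i} (h : indep P c ≠ 0) (i : ι) : P i (c i) ≠ 0 := by
  rw [indep_apply] at h
  exact (Finset.prod_ne_zero_iff.1 h) i (Finset.mem_univ i)

end Product

end

/-! ### Two interacting parties, their transcripts, and switching states. -/

section

/-! ### Interacting parties -/

theorem map_fun_id {α : Type} (μ : PMF α) : μ.map (fun a => a) = μ := PMF.map_id μ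

/-- A randomised state machine that in every round emits a message in `O`, receives a message
in `I` and draws its next state. -/
structure Party (S I O : Type) where
  init : PMF S
  out : S → O
  step : S → I → PMF S

namespace Party

variable {S S' Z Z' I O : Type}

/-- One simultaneous round of two parties that talk to each other. -/
def round (A : Party S I O) (B : Party Z O I) (s : S × Z) : PMF (S × Z) :=
  pmfProd (A.step s.1 (B.out s.2)) (B.step s.2 (A.out s.1))

/-- The law of the pair of states after `t` rounds. -/
def law (A : Party S I O) (B : Party Z O I) : ℕ → PMF (S × Z)
  | 0 => pmfProd A.init B.init
  | t + 1 => (law A B t).bind (round A B)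

/-- The law of the pair of states `r` rounds after being `s`. -/
def run (A : Party S I O) (B : Party Z O I) (s : S × Z) : ℕ → PMF (S × Z)
  | 0 => PMF.pure s
  | r + 1 => (run A B s r).bind (round A B)

theorem law_add (A : Party S I O) (B : Party Z O I) (t r : ℕ) :
    law A B (t + r) = (law A B t).bind fun s => run A B s r := by
  induction r with
  | zero => simp [run, PMF.bind_pure]
  | succ r ih => rw [← Nat.add_assoc, law, ih, PMF.bind_bind]; rfl

/-- A predicate on pairs of states that is never lost. -/
def Persistent (A : Party S I O) (B : Party Z O I) (E : S × Z → Prop) : Prop :=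
  ∀ s s', round A B s s' ≠ 0 → E s → E s'

theorem ex_round_mono {A : Party S I O} {B : Party Z O I} {E : S × Z → Prop}
    (h : Persistent A B E) (s : S × Z) :
    ind (E s) ≤ ex (round A B s) fun s' => ind (E s') := by
  by_cases hs : E s
  · rw [ind_of hs, ← ex_const (round A B s) 1]
    exact ex_mono_support fun s' hs' => by rw [ind_of (h s s' hs' hs)]
  · rw [ind_of_not hs]; exact zero_le

theorem law_mono {A : Party S I O} {B : Party Z O I} {E : S × Z → Prop}
    (h : Persistent A B E) : Monotone fun t => ex (law A B t) fun s => ind (E s) := by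
  refine monotone_nat_of_le_succ fun t => ?_
  rw [law, ex_bind]
  exact ex_mono (ex_round_mono h)

theorem run_mono {A : Party S I O} {B : Party Z O I} {E : S × Z → Prop}
    (h : Persistent A B E) (s : S × Z) :
    Monotone fun t => ex (run A B s t) fun s => ind (E s) := by
  refine monotone_nat_of_le_succ fun t => ?_
  rw [run, ex_bind]
  exact ex_mono (ex_round_mono h)

theorem run_persistent {A : Party S I O} {B : Party Z O I} {E : S × Z → Prop}
    (h : Persistent A B E) {s s' : S × Z} {r : ℕ} (hs : E s)
    (hr : run A B s r s' ≠ 0) : E s' := by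
  induction r generalizing s' with
  | zero =>
    rw [run, PMF.pure_apply] at hr
    split_ifs at hr with h'
    · exact h' ▸ hs
    · simp at hr
  | succ r ih =>
    rw [run, ← PMF.mem_support_iff, PMF.mem_support_bind_iff] at hr
    obtain ⟨s'', h1, h2⟩ := hr
    exact h s'' s' ((PMF.mem_support_iff _ _).1 h2) (ih ((PMF.mem_support_iff _ _).1 h1))

/-- If a persistent event almost surely happens, then it almost surely happens after any
reachable pair of states. -/
theorem iSup_run_eq_one {A : Party S I O} {B : Party Z O I} {E : S × Z → Prop}
    (h : Persistent A B E) (h1 : ⨆ t, ex (law A B t) (fun s => ind (E s)) = 1) {t : ℕ}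
    {s : S × Z} (hs : law A B t s ≠ 0) :
    ⨆ r, ex (run A B s r) (fun s => ind (E s)) = 1 := by
  -- The probability of success after time t averages to one over the states at time t and never
  -- exceeds one, so it is one at each reachable state.
  refine eq_one_of_ex_eq_one (μ := law A B t)
    (f := fun s => ⨆ r, ex (run A B s r) (fun s => ind (E s)))
    (fun s => iSup_le fun r => ex_le_one fun _ => ind_le_one _) ?_ hs
  rw [ex_iSup fun s => run_mono h s, ← h1]
  simp only [← ex_bind, ← law_add]
  refine le_antisymm (iSup_le fun r => le_iSup (fun t => ex (law A B t) fun s => ind (E s)) _)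
    (iSup_le fun r => ?_)
  exact (law_mono h (Nat.le_add_left r t)).trans
    (le_iSup (fun r => ex (law A B (t + r)) fun s => ind (E s)) r)

/-! #### Morphisms -/

/-- A map of states under which one party behaves as the other. -/
structure Hom (A : Party S I O) (A' : Party S' I O) where
  map : S → S'
  init : A.init.map map = A'.init
  out : ∀ s, A'.out (map s) = A.out s
  step : ∀ s i, (A.step s i).map map = A'.step (map s) i

/-- The identity morphism. -/
def Hom.id (A : Party S I O) : Hom A A :=
  ⟨fun s => s, PMF.map_id _, fun _ => rfl, fun _ _ => PMF.map_id _⟩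

theorem round_map {A : Party S I O} {A' : Party S' I O} {B : Party Z O I} {B' : Party Z' O I}
    (f : Hom A A') (g : Hom B B')
    (s : S × Z) :
    (round A B s).map (Prod.map f.map g.map) = round A' B' (Prod.map f.map g.map s) := by
  unfold round
  rw [pmfProd_map, f.step, g.step]
  simp [f.out, g.out]

/-- Each side sees only the messages of the other, so morphisms on the two sides can be applied
independently. This serves to forget records and to identify a deviation with the party that it
imitates. -/
theorem law_map {A : Party S I O} {A' : Party S' I O} {B : Party Z O I} {B' : Party Z' O I}
    (f : Hom A A') (g : Hom B B') (t : ℕ) :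
    (law A B t).map (Prod.map f.map g.map) = law A' B' t := by
  induction t with
  | zero => unfold law; rw [pmfProd_map, f.init, g.init]
  | succ t ih =>
    rw [law, law, ← ih, PMF.map_bind, PMF.bind_map]
    congr 1
    funext s
    exact round_map f g s

/-! #### Recording the transcript -/

/-- The party that in addition remembers all messages it has sent and received. -/
def record (A : Party S I O) : Party (S × List (O × I)) I O where
  init := A.init.map fun s => (s, [])
  out s := A.out s.1
  step s i := (A.step s.1 i).map fun s' => (s', (A.out s.1, i) :: s.2)

/-- Forgetting the record. -/
def recordHom (A : Party S I O) : Hom A.record A where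
  map := Prod.fst
  init := by simp [record, PMF.map_comp, Function.comp_def, map_fun_id]
  out _ := rfl
  step s i := by simp [record, PMF.map_comp, Function.comp_def, map_fun_id]

open Classical in
/-- The weight with which a party reaches a state with a given transcript, if it is fed the
incoming messages of that transcript. -/
def weight (A : Party S I O) : List (O × I) → S → ℝ≥0∞
  | [], s => A.init s
  | (o, i) :: c, s' => ∑' s, if A.out s = o then weight A c s * A.step s i s' else 0

/-- With the incoming messages prescribed, the total weight is the probability that the party
answers with the prescribed outgoing messages. It is not one in general. -/
theorem tsum_weight_le_one (A : Party S I O) (c : List (O × I)) : ∑' s, A.weight c s ≤ 1 := by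
  induction c with
  | nil => exact (PMF.tsum_coe A.init).le
  | cons m c ih =>
    obtain ⟨o, i⟩ := m
    simp only [weight]
    rw [ENNReal.tsum_comm]
    refine le_trans (ENNReal.tsum_le_tsum fun s => ?_) ih
    by_cases h : A.out s = o
    · simp [h, ENNReal.tsum_mul_left]
    · simp [h]

open Classical in
theorem map_pair_apply {α β : Type} (μ : PMF α) (b : β) (x : α × β) :
    μ.map (fun a => (a, b)) x = if x.2 = b then μ x.1 else 0 := by
  obtain ⟨a, b'⟩ := x
  rw [PMF.map_apply, tsum_eq_single a]
  · simp
  · intro a' ha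
    rw [if_neg]
    simp [ha.symm]

open Classical in
/-- Given the transcript, the two parties are independent. -/
theorem law_record_apply (A : Party S I O) (B : Party Z O I) (t : ℕ) (s : S)
    (c : List (O × I)) (z : Z) :
    law A.record B t ((s, c), z) =
      if c.length = t then A.weight c s * B.weight (c.map Prod.swap) z else 0 := by
  induction t generalizing s c z with
  | zero =>
    rw [law, pmfProd_apply]
    simp only [record]
    rw [map_pair_apply]
    cases c <;> simp [weight]
  | succ t ih =>
    rw [law, PMF.bind_apply]
    -- One round extends the transcript by exactly one pair, and both the law and the round kernel
    -- factor into a part for A and a part for B.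
    have key : ∀ g : (S × List (O × I)) × Z,
        law A.record B t g * round A.record B g ((s, c), z) =
          if c = (A.out g.1.1, B.out g.2) :: g.1.2 ∧ g.1.2.length = t then
            (A.weight g.1.2 g.1.1 * A.step g.1.1 (B.out g.2) s) *
              (B.weight (g.1.2.map Prod.swap) g.2 * B.step g.2 (A.out g.1.1) z) else 0 := by
      rintro ⟨⟨s₀, c₀⟩, z₀⟩
      rw [ih, round, pmfProd_apply]
      simp only [record]
      rw [map_pair_apply]
      by_cases h1 : c₀.length = t <;> by_cases h2 : c = (A.out s₀, B.out z₀) :: c₀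
      · simp only [h1, h2, and_self, if_true]; ring
      · simp [h2]
      · simp [h1]
      · simp [h1]
    refine (tsum_congr key).trans ?_
    cases c with
    | nil => simp
    | cons m c =>
      obtain ⟨o, i⟩ := m
      rw [ENNReal.tsum_prod', ENNReal.tsum_prod']
      simp only [List.length_cons, Nat.add_right_cancel_iff, List.map_cons, Prod.swap_prod_mk,
        weight]
      by_cases hc : c.length = t
      · rw [if_pos hc, ← ENNReal.tsum_mul_right]
        refine tsum_congr fun s₀ => ?_
        rw [tsum_eq_single c]
        · rw [← ENNReal.tsum_mul_left]
          refine tsum_congr fun z₀ => ?_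
          by_cases h1 : A.out s₀ = o <;> by_cases h2 : B.out z₀ = i
          · subst h1 h2; simp [hc]
          · simp [h2, Ne.symm h2]
          · simp [h1, Ne.symm h1]
          · simp [h1, Ne.symm h1]
        · intro c' hc'
          refine ENNReal.tsum_eq_zero.2 fun z₀ => if_neg ?_
          rintro ⟨h, -⟩
          simp only [List.cons.injEq] at h
          exact hc' h.2.symm
      · rw [if_neg hc]
        refine ENNReal.tsum_eq_zero.2 fun s₀ => ENNReal.tsum_eq_zero.2 fun c' =>
          ENNReal.tsum_eq_zero.2 fun z₀ => if_neg ?_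
        rintro ⟨h, h'⟩
        simp only [List.cons.injEq] at h
        exact hc (h.2 ▸ h')

theorem length_of_law_record_ne_zero {A : Party S I O} {B : Party Z O I} {t : ℕ}
    {g : (S × List (O × I)) × Z} (h : law A.record B t g ≠ 0) : g.1.2.length = t := by
  obtain ⟨⟨s, c⟩, z⟩ := g
  rw [law_record_apply] at h
  by_contra hne
  exact h (if_neg hne)

/-! #### Switching to another state -/

section Switch

variable (c₀ : List (O × I)) (z₀ : Z)

open Classical in
/-- Replace the state by `z₀` if the transcript is `c₀`. -/
def redirect (z : Z) (c : List (O × I)) : Z := if c = c₀ then z₀ else z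

/-- The party that behaves as `B`, except that it continues from the state `z₀` once the
transcript is `c₀`. -/
def switch (B : Party Z O I) : Party (Z × List (O × I)) O I where
  init := B.init.map fun z => (redirect c₀ z₀ z [], [])
  out z := B.out z.1
  step z o := (B.step z.1 o).map fun z' =>
    (redirect c₀ z₀ z' ((o, B.out z.1) :: z.2), (o, B.out z.1) :: z.2)

theorem redirect_of_ne {c : List (O × I)} (h : c ≠ c₀) (z : Z) :
    redirect c₀ z₀ z c = z := if_neg h

/-- Up to time `c₀.length` the redirection can only act on arrival at a transcript of that length.
Hence the execution is the honest one with the redirection applied once at the end; whether A or B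
keeps the record makes no difference. -/
theorem law_switch_of_le (A : Party S I O) (B : Party Z O I) {t : ℕ} (ht : t ≤ c₀.length) :
    law A (B.switch c₀ z₀) t =
      (law A.record B t).map fun g => (g.1.1, (redirect c₀ z₀ g.2 g.1.2, g.1.2)) := by
  induction t with
  | zero =>
    simp only [law, pmfProd, record, switch, PMF.map_bind, PMF.bind_map, PMF.map_comp,
      Function.comp_def]
  | succ t ih =>
    rw [law, ih (by omega), law, PMF.bind_map, PMF.map_bind]
    refine bind_congr_support fun g hg => ?_
    have hl := length_of_law_record_ne_zero hg
    have hne : g.1.2 ≠ c₀ := by rintro h; rw [h] at hl; omega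
    simp only [Function.comp_def, redirect_of_ne c₀ z₀ hne]
    simp only [round, pmfProd, record, switch, PMF.map_bind, PMF.bind_map, PMF.map_comp,
      Function.comp_def]

/-- Past the length of `c₀` no transcript equals `c₀` again, so the switched party runs as `B` from
the redirected state. The indicator, which is one at these times, matches the rule that the deviator
outputs nothing before the switching time. -/
theorem ex_law_switch (A : Party S I O) (B : Party Z O I) (r : ℕ) (F : S × Z → ℝ≥0∞) :
    ex (law A (B.switch c₀ z₀) (c₀.length + r)) (fun g => ind (c₀.length ≤ g.2.2.length) *
        F (g.1, g.2.1)) =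
      ex (law A.record B c₀.length) fun g =>
        ex (run A B (g.1.1, redirect c₀ z₀ g.2 g.1.2) r) F := by
  -- Only the length of the transcript is tracked: it suffices to exclude another redirection, and
  -- it keeps the induction free of the transcript itself.
  have main : (law A (B.switch c₀ z₀) (c₀.length + r)).map
        (fun g => ((g.1, g.2.1), g.2.2.length)) =
      (law A.record B c₀.length).bind fun g =>
        (run A B (g.1.1, redirect c₀ z₀ g.2 g.1.2) r).map fun s => (s, c₀.length + r) := by
    induction r with
    | zero =>
      rw [Nat.add_zero, law_switch_of_le c₀ z₀ A B le_rfl, PMF.map_comp, ← PMF.bind_pure_comp]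
      refine bind_congr_support fun g hg => ?_
      simp [run, PMF.pure_map, length_of_law_record_ne_zero hg]
    | succ r ih =>
      have step : ∀ g : S × (Z × List (O × I)), c₀.length ≤ g.2.2.length →
          (round A (B.switch c₀ z₀) g).map (fun g => ((g.1, g.2.1), g.2.2.length)) =
            (round A B (g.1, g.2.1)).map fun s => (s, g.2.2.length + 1) := by
        rintro ⟨a, z, c⟩ hc
        have hne : (A.out a, B.out z) :: c ≠ c₀ := by
          rintro h; rw [← h] at hc; simp at hc
        simp only [round, pmfProd, switch, PMF.map_bind, PMF.map_comp, Function.comp_def,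
          redirect_of_ne c₀ z₀ hne, List.length_cons]
      have hlen : ∀ g, law A (B.switch c₀ z₀) (c₀.length + r) g ≠ 0 →
          g.2.2.length = c₀.length + r := by
        intro g hg
        have : ((g.1, g.2.1), g.2.2.length) ∈ ((law A (B.switch c₀ z₀) (c₀.length + r)).map
            (fun g => ((g.1, g.2.1), g.2.2.length))).support :=
          (PMF.mem_support_map_iff _ _ _).2 ⟨g, (PMF.mem_support_iff _ _).2 hg, rfl⟩
        rw [ih, PMF.mem_support_bind_iff] at this
        obtain ⟨g', -, h⟩ := this
        obtain ⟨s, -, h⟩ := (PMF.mem_support_map_iff _ _ _).1 h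
        simpa using (congrArg Prod.snd h).symm
      have h1 : (law A (B.switch c₀ z₀) (c₀.length + (r + 1))).map
            (fun g => ((g.1, g.2.1), g.2.2.length)) =
          ((law A (B.switch c₀ z₀) (c₀.length + r)).map
            (fun g => ((g.1, g.2.1), g.2.2.length))).bind
              fun x => (round A B x.1).map fun s => (s, x.2 + 1) := by
        rw [← Nat.add_assoc, law, PMF.map_bind, PMF.bind_map]
        exact bind_congr_support fun g hg => step g (by rw [hlen g hg]; omega)
      rw [h1, ih, PMF.bind_bind]
      congr 1
      funext g
      rw [PMF.bind_map, run, PMF.map_bind]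
      rfl
  have := congrArg (fun μ => ex μ fun x => ind (c₀.length ≤ x.2) * F x.1) main
  simp only [ex_map, ex_bind] at this
  rw [this]
  simp [ind]

end Switch

end Party

end

/-! ### Mixtures, three parties in a row, and profitable switches. -/

section

namespace Party

/-! #### Mixtures -/

section Mix

variable {I O Z ι : Type} {S : ι → Type}

/-- The party that first draws which of the parties `P i` it is. -/
def mix (π : PMF ι) (P : ∀ i, Party (S i) I O) : Party (Σ i, S i) I O where
  init := π.bind fun i => (P i).init.map (Sigma.mk i)
  out s := (P s.1).out s.2
  step s i := ((P s.1).step s.2 i).map (Sigma.mk s.1)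

/-- The index is drawn once and never changes, so the execution is a mixture of executions. -/
theorem law_mix (π : PMF ι) (P : ∀ i, Party (S i) I O) (B : Party Z O I) (t : ℕ) :
    law (mix π P) B t = π.bind fun i => (law (P i) B t).map fun g => (⟨i, g.1⟩, g.2) := by
  induction t with
  | zero =>
    simp only [law, mix, pmfProd, PMF.bind_bind, PMF.bind_map, PMF.map_bind, PMF.map_comp,
      Function.comp_def]
  | succ t ih =>
    simp only [law, ih, PMF.bind_bind, PMF.bind_map, PMF.map_bind]
    simp only [round, mix, pmfProd, PMF.bind_map, PMF.map_bind, PMF.map_comp, Function.comp_def]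

theorem ex_law_mix (π : PMF ι) (P : ∀ i, Party (S i) I O) (B : Party Z O I) (t : ℕ)
    (F : (Σ i, S i) × Z → ℝ≥0∞) :
    ex (law (mix π P) B t) F =
      ex π fun i => ex (law (P i) B t) fun g => F (⟨i, g.1⟩, g.2) := by
  rw [law_mix, ex_bind]
  simp only [ex_map]

end Mix

/-! #### A party between two others -/

section Attach

variable {m S S' Q : Type}

/-- Exchange the two sides of a party that talks to two others. -/
def swap (R : Party Q (m × m) (m × m)) : Party Q (m × m) (m × m) where
  init := R.init
  out s := (R.out s).swap
  step s i := R.step s i.swap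

/-- The party consisting of `R` and of `A`, which is attached to the second side of `R`. -/
def attach (R : Party Q (m × m) (m × m)) (A : Party S m m) : Party (Q × S) m m where
  init := pmfProd R.init A.init
  out z := (R.out z.1).1
  step z i := pmfProd (R.step z.1 (i, A.out z.2)) (A.step z.2 (R.out z.1).2)

/-- Attaching is functorial. -/
def attachHom (R : Party Q (m × m) (m × m)) {A : Party S m m} {A' : Party S' m m}
    (f : Hom A A') : Hom (attach R A) (attach R A') where
  map := Prod.map (fun r => r) f.map
  init := by simp only [attach]; rw [pmfProd_map, f.init, map_fun_id]
  out _ := rfl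
  step z i := by
    simp only [attach]
    rw [pmfProd_map, f.step, map_fun_id]
    simp [f.out]

/-- Exchanging the roles of the two outer parties. -/
def permute : S × (Q × S') ≃ S' × (Q × S) where
  toFun g := (g.2.2, (g.2.1, g.1))
  invFun g := (g.2.2, (g.2.1, g.1))
  left_inv _ := rfl
  right_inv _ := rfl

/-- A row of three parties can be cut on either side of the middle one. Both cuts describe the same
joint law, which lets statements at one cut be used at the other. -/
theorem law_permute (R : Party Q (m × m) (m × m)) (A : Party S m m) (A' : Party S' m m) (t : ℕ) :
    (law A (attach R A') t).map permute = law A' (attach R.swap A) t := by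
  induction t with
  | zero =>
    ext g
    rw [map_equiv_apply]
    simp only [law, attach, swap, permute, pmfProd_apply, Equiv.coe_fn_symm_mk]
    ring
  | succ t ih =>
    rw [law, law, ← ih, PMF.map_bind, PMF.bind_map]
    congr 1
    funext g
    ext g'
    rw [map_equiv_apply]
    simp only [round, attach, swap, permute, pmfProd_apply, Equiv.coe_fn_symm_mk,
      Function.comp_apply, Equiv.coe_fn_mk, Prod.swap_prod_mk, Prod.fst_swap, Prod.snd_swap]
    ring

theorem ex_law_permute (R : Party Q (m × m) (m × m)) (A : Party S m m) (A' : Party S' m m)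
    (t : ℕ) (F : S' × (Q × S) → ℝ≥0∞) :
    ex (law A' (attach R.swap A) t) F =
      ex (law A (attach R A') t) fun g => F (g.2.2, (g.2.1, g.1)) := by
  rw [← law_permute, ex_map]
  rfl

end Attach

/-! #### Profitable switches -/

section Switching

variable {S Z I O : Type}

/-- The probability of `good` if the second party moves to the state `z₀` when the transcript
is `c₀`. -/
def payoff (A : Party S I O) (B : Party Z O I) (good : S → Z → Prop) (c₀ : List (O × I))
    (z₀ : Z) : ℝ≥0∞ :=
  ex (law A.record B c₀.length) fun g => ind (good g.1.1 (redirect c₀ z₀ g.2 g.1.2))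

open Classical in
theorem ex_law_record (A : Party S I O) (B : Party Z O I) (t : ℕ)
    (h : (S × List (O × I)) × Z → ℝ≥0∞) :
    ex (law A.record B t) h = ∑' c, if c.length = t then
      ∑' z, B.weight (c.map Prod.swap) z * ∑' s, A.weight c s * h ((s, c), z) else 0 := by
  unfold ex
  rw [ENNReal.tsum_prod', ENNReal.tsum_prod', ENNReal.tsum_comm]
  refine tsum_congr fun c => ?_
  simp only [law_record_apply]
  split_ifs with hc
  · rw [ENNReal.tsum_comm]
    refine tsum_congr fun z => ?_
    rw [← ENNReal.tsum_mul_left]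
    refine tsum_congr fun s => ?_
    ring
  · simp

theorem ex_law_record_single (A : Party S I O) (B : Party Z O I) (c : List (O × I))
    (h : S → Z → ℝ≥0∞) :
    ex (law A.record B c.length) (fun g => ind (g.1.2 = c) * h g.1.1 g.2) =
      ∑' z, B.weight (c.map Prod.swap) z * ∑' s, A.weight c s * h s z := by
  rw [ex_law_record, tsum_eq_single c]
  · simp [ind]
  · intro c' hc'
    simp [ind, hc']

theorem ind_redirect (good : S → Z → Prop) (c₀ : List (O × I)) (z₀ : Z)
    (g : (S × List (O × I)) × Z) :
    ind (good g.1.1 (redirect c₀ z₀ g.2 g.1.2)) =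
      ind (g.1.2 ≠ c₀) * ind (good g.1.1 g.2) + ind (g.1.2 = c₀) * ind (good g.1.1 z₀) := by
  by_cases h : g.1.2 = c₀
  · have : redirect c₀ z₀ g.2 g.1.2 = z₀ := if_pos h
    rw [this]
    simp [ind, h]
  · rw [redirect_of_ne c₀ z₀ h]
    simp [ind, h]

theorem ex_ne_top {α : Type} (μ : PMF α) {f : α → ℝ≥0∞} (h : ∀ a, f a ≤ 1) : ex μ f ≠ ∞ :=
  ((ex_le_one h).trans_lt ENNReal.one_lt_top).ne

theorem ind_mul_ind_le_one (P P' : Prop) : ind P * ind P' ≤ 1 := by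
  rw [← ind_and]; exact ind_le_one _

/-- If the transcript carries no information on `good` and no switch is profitable, then
the state of the second party carries no information either. -/
theorem uninformative_of_no_gain {A : Party S I O} {B : Party Z O I} {good : S → Z → Prop}
    {θ : ℝ≥0∞} (hθ : θ ≠ ∞) {t : ℕ}
    (hU : ∀ c, ex (law A.record B t) (fun g => ind (g.1.2 = c) * ind (good g.1.1 g.2)) =
      θ * ex (law A.record B t) fun g => ind (g.1.2 = c))
    (hgood : ex (law A.record B t) (fun g => ind (good g.1.1 g.2)) = θ)
    (hno : ∀ c z, B.weight (c.map Prod.swap) z ≠ 0 → payoff A B good c z ≤ θ) (F : Z → ℝ≥0∞) :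
    ex (law A.record B t) (fun g => F g.2 * ind (good g.1.1 g.2)) =
      θ * ex (law A.record B t) fun g => F g.2 := by
  -- Conditioned on the transcript c, each state z of B of positive weight leaves probability
  -- exactly θ for `good`.
  have key : ∀ c : List (O × I), c.length = t → ∀ z,
      B.weight (c.map Prod.swap) z * ∑' s, A.weight c s * ind (good s z) =
        B.weight (c.map Prod.swap) z * (θ * ∑' s, A.weight c s) := by
    rintro c rfl
    set a := ∑' s, A.weight c s with ha
    set b := ∑' z, B.weight (c.map Prod.swap) z with hb
    have ha1 : a ≤ 1 := tsum_weight_le_one A c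
    have hb1 : b ≤ 1 := tsum_weight_le_one B _
    have htot : ex (law A.record B c.length) (fun g => ind (g.1.2 = c)) = b * a := by
      have := ex_law_record_single A B c fun _ _ => 1
      simp only [mul_one] at this
      rw [this, ENNReal.tsum_mul_right]
    have hUc := hU c
    rw [ex_law_record_single A B c fun s z => ind (good s z), htot] at hUc
    have hle : ∀ z, B.weight (c.map Prod.swap) z ≠ 0 →
        ∑' s, A.weight c s * ind (good s z) ≤ θ * a := by
      intro z hz
      -- The switch changes nothing off the transcript c, so that contribution cancels and the bound
      -- on the payoff becomes a bound conditional on c.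
      have h1 : ex (law A.record B c.length) (fun g => ind (g.1.2 ≠ c) * ind (good g.1.1 g.2)) +
          ex (law A.record B c.length) (fun g => ind (g.1.2 = c) * ind (good g.1.1 z)) ≤
          ex (law A.record B c.length) (fun g => ind (g.1.2 ≠ c) * ind (good g.1.1 g.2)) +
          ex (law A.record B c.length) (fun g => ind (g.1.2 = c) * ind (good g.1.1 g.2)) := by
        rw [← ex_add, ← ex_add]
        calc _ = payoff A B good c z := by
              unfold payoff; exact congrArg _ (funext fun g => (ind_redirect good c z g).symm)
          _ ≤ θ := hno c z hz
          _ = _ := by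
              rw [← hgood]
              refine congrArg _ (funext fun g => ?_)
              by_cases h : g.1.2 = c <;> simp [ind, h]
      have h2 := (ENNReal.add_le_add_iff_left
        (ex_ne_top _ fun g => ind_mul_ind_le_one _ _)).1 h1
      rw [ex_law_record_single A B c fun s _ => ind (good s z),
        ex_law_record_single A B c fun s z => ind (good s z), hUc, ENNReal.tsum_mul_right,
        ← hb, ← mul_assoc, mul_comm θ b, mul_assoc] at h2
      have hb0 : b ≠ 0 := fun h => hz (ENNReal.tsum_eq_zero.1 h z)
      exact (ENNReal.mul_le_mul_iff_right hb0 (hb1.trans_lt ENNReal.one_lt_top).ne).1 h2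
    have hle' : ∀ z, B.weight (c.map Prod.swap) z * ∑' s, A.weight c s * ind (good s z) ≤
        B.weight (c.map Prod.swap) z * (θ * a) := by
      intro z
      by_cases hz : B.weight (c.map Prod.swap) z = 0
      · simp [hz]
      · gcongr; exact hle z hz
    intro z
    -- Termwise upper bounds whose sums agree must be equalities; the sums agree because the
    -- transcript is uninformative.
    by_contra hne
    have hlt := lt_of_le_of_ne (hle' z) hne
    have hfin : ∑' z, B.weight (c.map Prod.swap) z * ∑' s, A.weight c s * ind (good s z) ≠ ∞ := by
      rw [hUc]
      exact ENNReal.mul_ne_top hθ (ENNReal.mul_ne_top (hb1.trans_lt ENNReal.one_lt_top).ne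
        (ha1.trans_lt ENNReal.one_lt_top).ne)
    have := ENNReal.tsum_lt_tsum hfin hle' hlt
    rw [hUc, ENNReal.tsum_mul_right, ← hb, ← mul_assoc, ← mul_assoc, mul_comm θ b] at this
    exact lt_irrefl _ this
  rw [ex_law_record, ex_law_record, ← ENNReal.tsum_mul_left]
  refine tsum_congr fun c => ?_
  split_ifs with hc
  · rw [← ENNReal.tsum_mul_left]
    refine tsum_congr fun z => ?_
    have h1 : ∑' s, A.weight c s * (F z * ind (good s z)) =
        F z * ∑' s, A.weight c s * ind (good s z) := by
      rw [← ENNReal.tsum_mul_left]; exact tsum_congr fun s => by ring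
    have := key c hc z
    simp only [] at this ⊢
    rw [h1, ENNReal.tsum_mul_right, mul_left_comm, this]
    ring
  · simp

/-- A profitable switch is turned into a profitable party. -/
theorem lt_ex_law_switch {A : Party S I O} {B : Party Z O I} {good : S → Z → Prop} {θ : ℝ≥0∞}
    {E : S × Z → Prop} (hE : Persistent A B E)
    (hreach : ∀ t s, law A B t s ≠ 0 → good s.1 s.2 →
      ⨆ r, ex (run A B s r) (fun s => ind (E s)) = 1)
    {c : List (O × I)} {z : Z} (hz : B.weight (c.map Prod.swap) z ≠ 0)
    (hθ : θ < payoff A B good c z) :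
    ∃ t, θ < ex (law A (B.switch c z) t) fun g =>
      ind (c.length ≤ g.2.2.length) * ind (E (g.1, g.2.1)) := by
  have h1 : payoff A B good c z ≤ ex (law A.record B c.length) fun g =>
      ⨆ r, ex (run A B (g.1.1, redirect c z g.2 g.1.2) r) (fun s => ind (E s)) := by
    refine ex_mono_support fun g hg => ?_
    by_cases hgood : good g.1.1 (redirect c z g.2 g.1.2)
    · rw [hreach c.length (g.1.1, redirect c z g.2 g.1.2) ?_ hgood]
      · exact ind_le_one _
      -- After a switch, both the state of A and `z` have positive weight for the same transcript.
      -- By conditional independence the pair is reachable honestly, so the honest guarantee applies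
      -- to it.
      have hreach' : law A.record B c.length (g.1, redirect c z g.2 g.1.2) ≠ 0 := by
        by_cases hc : g.1.2 = c
        · obtain ⟨⟨s, c'⟩, z'⟩ := g
          simp only at hc
          subst hc
          simp only [redirect, if_true] at *
          rw [law_record_apply] at hg ⊢
          simp only [if_true] at hg ⊢
          exact mul_ne_zero (left_ne_zero_of_mul hg) hz
        · rwa [redirect_of_ne c z hc]
      rw [← law_map (recordHom A) (Hom.id B), ← PMF.mem_support_iff, PMF.mem_support_map_iff]
      exact ⟨_, (PMF.mem_support_iff _ _).2 hreach', rfl⟩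
    · rw [ind_of_not hgood]; exact zero_le
  have h2 := hθ.trans_le h1
  rw [ex_iSup fun g => run_mono hE _, lt_iSup_iff] at h2
  obtain ⟨r, hr⟩ := h2
  refine ⟨c.length + r, ?_⟩
  rw [ex_law_switch c z A B r fun s => ind (E s)]
  exact hr

end Switching

end Party

end

/-! ### A row of three parties cannot compute without leaking a profitable switch. -/

section

namespace Party

/-! #### Two parties that are connected through a third one -/

section Setting

variable {m S₁ S₂ Q : Type}

/-- Two parties `A₁`, `A₂` that compute, through a party `R` between them, whether a fact `good`
about the two of them holds. `Correct` means that all have output the right value, and `E₁`,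
`EQ`, `E₂` that the respective party has output that `good` holds. -/
structure Setting (A₁ : Party S₁ m m) (A₂ : Party S₂ m m) (R : Party Q (m × m) (m × m))
    (good : S₁ → S₂ → Prop) (Correct : S₁ → Q → S₂ → Prop)
    (E₁ : S₁ → Prop) (EQ : Q → Prop) (E₂ : S₂ → Prop) (θ : ℝ≥0∞) : Prop where
  good₁ : ∀ s i s', A₁.step s i s' ≠ 0 → ∀ z, good s' z ↔ good s z
  good₂ : ∀ s i s', A₂.step s i s' ≠ 0 → ∀ z, good z s' ↔ good z s
  persist₁ : ∀ s i s', A₁.step s i s' ≠ 0 → E₁ s → E₁ s'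
  persist₂ : ∀ s i s', A₂.step s i s' ≠ 0 → E₂ s → E₂ s'
  persistQ : ∀ s i s', R.step s i s' ≠ 0 → EQ s → EQ s'
  persist : ∀ s₁ i₁ s₁' r i r' s₂ i₂ s₂', A₁.step s₁ i₁ s₁' ≠ 0 → R.step r i r' ≠ 0 →
    A₂.step s₂ i₂ s₂' ≠ 0 → Correct s₁ r s₂ → Correct s₁' r' s₂'
  output : ∀ s₁ r s₂, Correct s₁ r s₂ → good s₁ s₂ → E₁ s₁ ∧ EQ r ∧ E₂ s₂
  sound : ∀ s₁ r s₂, Correct s₁ r s₂ → EQ r → good s₁ s₂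
  prob : ex (law A₁ (attach R A₂) 0) (fun g => ind (good g.1 g.2.2)) = θ
  correct : ⨆ t, ex (law A₁ (attach R A₂) t) (fun g => ind (Correct g.1 g.2.1 g.2.2)) = 1

variable {A₁ : Party S₁ m m} {A₂ : Party S₂ m m} {R : Party Q (m × m) (m × m)}
  {good : S₁ → S₂ → Prop} {Correct : S₁ → Q → S₂ → Prop}
  {E₁ : S₁ → Prop} {EQ : Q → Prop} {E₂ : S₂ → Prop} {θ : ℝ≥0∞}

theorem Setting.swap (h : Setting A₁ A₂ R good Correct E₁ EQ E₂ θ) :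
    Setting A₂ A₁ R.swap (fun s z => good z s) (fun s r z => Correct z r s) E₂ EQ E₁ θ where
  good₁ := h.good₂
  good₂ := h.good₁
  persist₁ := h.persist₂
  persist₂ := h.persist₁
  persistQ s i s' := h.persistQ s i.swap s'
  persist s₁ i₁ s₁' r i r' s₂ i₂ s₂' h1 h2 h3 :=
    h.persist s₂ i₂ s₂' r i.swap r' s₁ i₁ s₁' h3 h2 h1
  output s₁ r s₂ hc hg := by
    obtain ⟨a, b, c⟩ := h.output s₂ r s₁ hc hg
    exact ⟨c, b, a⟩
  sound s₁ r s₂ := h.sound s₂ r s₁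
  prob := by rw [ex_law_permute]; exact h.prob
  correct := by simp only [ex_law_permute]; exact h.correct

theorem record_step_ne_zero {I O S : Type} {A : Party S I O} {s s' : S × List (O × I)} {i : I}
    (h : A.record.step s i s' ≠ 0) :
    A.step s.1 i s'.1 ≠ 0 ∧ s'.2 = (A.out s.1, i) :: s.2 := by
  obtain ⟨a, ha, rfl⟩ := (PMF.mem_support_map_iff _ _ _).1 ((PMF.mem_support_iff _ _).2 h)
  exact ⟨(PMF.mem_support_iff _ _).1 ha, rfl⟩

theorem attach_step_ne_zero {S : Type} {A : Party S m m} {z z' : Q × S} {i : m}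
    (h : (attach R A).step z i z' ≠ 0) :
    R.step z.1 (i, A.out z.2) z'.1 ≠ 0 ∧ A.step z.2 (R.out z.1).2 z'.2 ≠ 0 := by
  simp only [attach, pmfProd_apply] at h
  exact mul_ne_zero_iff.1 h

theorem round_ne_zero {S Z I O : Type} {A : Party S I O} {B : Party Z O I} {s s' : S × Z}
    (h : round A B s s' ≠ 0) :
    A.step s.1 (B.out s.2) s'.1 ≠ 0 ∧ B.step s.2 (A.out s.1) s'.2 ≠ 0 := by
  simp only [round, pmfProd_apply] at h
  exact mul_ne_zero_iff.1 h

theorem round_record_attach_record {g g' : (S₁ × List (m × m)) × (Q × (S₂ × List (m × m)))}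
    (h : round A₁.record (attach R A₂.record) g g' ≠ 0) :
    A₁.step g.1.1 (R.out g.2.1).1 g'.1.1 ≠ 0 ∧
      A₂.step g.2.2.1 (R.out g.2.1).2 g'.2.2.1 ≠ 0 ∧
      g'.1.2 = (A₁.out g.1.1, (R.out g.2.1).1) :: g.1.2 := by
  obtain ⟨h1, h2⟩ := round_ne_zero h
  obtain ⟨h3, h4⟩ := record_step_ne_zero h1
  obtain ⟨-, h5⟩ := attach_step_ne_zero h2
  exact ⟨h3, (record_step_ne_zero h5).1, h4⟩

theorem ex_transcript_succ (F : List (m × m) → ℝ≥0∞) (t : ℕ) :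
    ex (law A₁.record (attach R A₂.record) (t + 1)) (fun g => F g.1.2) =
      ex (law A₁.record (attach R A₂.record) t) fun g =>
        F ((A₁.out g.1.1, (R.out g.2.1).1) :: g.1.2) := by
  rw [law, ex_bind]
  refine congrArg _ (funext fun g => ?_)
  rw [← ex_const (round A₁.record (attach R A₂.record) g)
    (F ((A₁.out g.1.1, (R.out g.2.1).1) :: g.1.2))]
  refine ex_congr_support fun g' hg' => ?_
  rw [(round_record_attach_record hg').2.2]

theorem ex_law_forget (t : ℕ) (F : S₁ × (Q × S₂) → ℝ≥0∞) :
    ex (law A₁.record (attach R A₂.record) t) (fun g => F (g.1.1, (g.2.1, g.2.2.1))) =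
      ex (law A₁ (attach R A₂) t) F := by
  rw [← law_map (recordHom A₁) (attachHom R (recordHom A₂)), ex_map]
  rfl

theorem ex_law_forget_right (t : ℕ) (F : S₁ × (Q × S₂) → ℝ≥0∞) :
    ex (law A₁ (attach R A₂.record) t) (fun g => F (g.1, (g.2.1, g.2.2.1))) =
      ex (law A₁ (attach R A₂) t) F := by
  rw [← law_map (Hom.id A₁) (attachHom R (recordHom A₂)), ex_map]
  rfl

/-- The transcript of the cut between `A₁` and the others is uninformative after `t` rounds. -/
def Uninformative (A₁ : Party S₁ m m) (A₂ : Party S₂ m m)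
    (R : Party Q (m × m) (m × m)) (good : S₁ → S₂ → Prop) (θ : ℝ≥0∞) (t : ℕ) : Prop :=
  ∀ c, ex (law A₁.record (attach R A₂.record) t)
      (fun g => ind (g.1.2 = c) * ind (good g.1.1 g.2.2.1)) =
    θ * ex (law A₁.record (attach R A₂.record) t) fun g => ind (g.1.2 = c)

/-- No switch at the cut between `A₁` and the others is profitable. -/
def NoGain (A₁ : Party S₁ m m) (A₂ : Party S₂ m m)
    (R : Party Q (m × m) (m × m)) (good : S₁ → S₂ → Prop) (θ : ℝ≥0∞) : Prop :=
  ∀ c z, (attach R A₂.record).weight (c.map Prod.swap) z ≠ 0 →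
    payoff A₁ (attach R A₂.record) (fun s z => good s z.2.1) c z ≤ θ

namespace Setting

/-- No step alters whether `good` holds, and the next transcript is determined by the current
states, so the expectation can be evaluated one round earlier. -/
theorem ex_good_succ (h : Setting A₁ A₂ R good Correct E₁ EQ E₂ θ)
    (F : List (m × m) → ℝ≥0∞) (t : ℕ) :
    ex (law A₁.record (attach R A₂.record) (t + 1)) (fun g => F g.1.2 * ind (good g.1.1 g.2.2.1)) =
      ex (law A₁.record (attach R A₂.record) t) fun g =>
        F ((A₁.out g.1.1, (R.out g.2.1).1) :: g.1.2) * ind (good g.1.1 g.2.2.1) := by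
  rw [law, ex_bind]
  refine congrArg _ (funext fun g => ?_)
  rw [← ex_const (round A₁.record (attach R A₂.record) g)
    (F ((A₁.out g.1.1, (R.out g.2.1).1) :: g.1.2) * ind (good g.1.1 g.2.2.1))]
  refine ex_congr_support fun g' hg' => ?_
  obtain ⟨h1, h2, h3⟩ := round_record_attach_record hg'
  rw [h3, ind_congr ((h.good₁ _ _ _ h1 _).trans (h.good₂ _ _ _ h2 _))]

theorem prob_good (h : Setting A₁ A₂ R good Correct E₁ EQ E₂ θ) (t : ℕ) :
    ex (law A₁.record (attach R A₂.record) t) (fun g => ind (good g.1.1 g.2.2.1)) = θ := by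
  induction t with
  | zero => rw [ex_law_forget 0 fun g => ind (good g.1 g.2.2)]; exact h.prob
  | succ t ih => have := h.ex_good_succ (fun _ => 1) t; simp only [one_mul] at this; rw [this, ih]

theorem uninformative_zero (h : Setting A₁ A₂ R good Correct E₁ EQ E₂ θ) :
    Uninformative A₁ A₂ R good θ 0 := by
  intro c
  have hc : ∀ g, law A₁.record (attach R A₂.record) 0 g ≠ 0 → g.1.2 = [] := fun g hg =>
    List.length_eq_zero_iff.1 (length_of_law_record_ne_zero hg)
  have h1 : ex (law A₁.record (attach R A₂.record) 0)
      (fun g => ind (g.1.2 = c) * ind (good g.1.1 g.2.2.1)) =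
      ex (law A₁.record (attach R A₂.record) 0)
        (fun g => ind ([] = c) * ind (good g.1.1 g.2.2.1)) :=
    ex_congr_support fun g hg => by rw [hc g hg]
  have h2 : ex (law A₁.record (attach R A₂.record) 0) (fun g => ind (g.1.2 = c)) =
      ex (law A₁.record (attach R A₂.record) 0) (fun _ => ind ([] = c)) :=
    ex_congr_support fun g hg => by rw [hc g hg]
  rw [h1, h2, ex_const]
  by_cases hn : [] = c
  · simp only [ind_of hn, one_mul, mul_one]; exact h.prob_good 0
  · simp only [ind_of_not hn, zero_mul, mul_zero, ex_const]

theorem state_uninformative (h : Setting A₁ A₂ R good Correct E₁ EQ E₂ θ)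
    (hθ : θ ≠ ∞) (hno : NoGain A₁ A₂ R good θ) {t : ℕ}
    (hU : Uninformative A₁ A₂ R good θ t) (F : Q × (S₂ × List (m × m)) → ℝ≥0∞) :
    ex (law A₁.record (attach R A₂.record) t) (fun g => F g.2 * ind (good g.1.1 g.2.2.1)) =
      θ * ex (law A₁.record (attach R A₂.record) t) fun g => F g.2 :=
  uninformative_of_no_gain (A := A₁) (B := attach R A₂.record)
    (good := fun s z => good s z.2.1) (t := t) hθ hU (h.prob_good t) hno F

/-- The transcript of `A₁` after t + 1 rounds is a function of the states of `R` and of the recorded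
`A₁` after t rounds. Together these form the party facing `A₂`, whose state is uninformative by the
assumption on the other cut. -/
theorem uninformative_succ (h : Setting A₁ A₂ R good Correct E₁ EQ E₂ θ) (hθ : θ ≠ ∞)
    (hno : NoGain A₂ A₁ R.swap (fun s z => good z s) θ) {t : ℕ}
    (hU : Uninformative A₂ A₁ R.swap (fun s z => good z s) θ t) :
    Uninformative A₁ A₂ R good θ (t + 1) := by
  intro c
  have := h.swap.state_uninformative hθ hno hU fun z =>
    ind ((A₁.out z.2.1, (R.out z.1).1) :: z.2.2 = c)
  simp only [ex_law_permute] at this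
  rw [h.ex_good_succ (fun c' => ind (c' = c)), ex_transcript_succ fun c' => ind (c' = c)]
  exact this

/-- The state of `R` would be independent of `good` at all times, while its output agrees with
`good` up to an error tending to zero. In the limit this says θ = θ². -/
theorem not_noGain (h : Setting A₁ A₂ R good Correct E₁ EQ E₂ θ) (h0 : θ ≠ 0) (h1 : θ < 1)
    (hno : NoGain A₁ A₂ R good θ) (hno' : NoGain A₂ A₁ R.swap (fun s z => good z s) θ) :
    False := by
  have hθ : θ ≠ ∞ := (h1.trans ENNReal.one_lt_top).ne
  have hU : ∀ t, Uninformative A₁ A₂ R good θ t ∧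
      Uninformative A₂ A₁ R.swap (fun s z => good z s) θ t := by
    intro t
    induction t with
    | zero => exact ⟨h.uninformative_zero, h.swap.uninformative_zero⟩
    | succ t ih =>
      exact ⟨h.uninformative_succ hθ hno' ih.2, h.swap.uninformative_succ hθ hno ih.1⟩
  have hsq : θ * θ < θ := by
    calc θ * θ < θ * 1 := ENNReal.mul_lt_mul_right h0 hθ h1
      _ = θ := mul_one θ
  -- The error δ is spent twice, once in each comparison of `EQ` with `good`; a third of θ − θ²
  -- leaves room for both.
  obtain ⟨δ, hδ, hδ'⟩ : ∃ δ : ℝ≥0∞, 0 < δ ∧ θ * θ + 2 * δ < θ := by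
    refine ⟨(θ - θ * θ) / 3, ENNReal.div_pos (tsub_pos_of_lt hsq).ne' (by simp), ?_⟩
    lift θ to NNReal using hθ
    have hsq' : θ * θ < θ := by exact_mod_cast hsq
    norm_cast
    rw [← NNReal.coe_lt_coe] at hsq' ⊢
    push_cast at hsq' ⊢
    rw [NNReal.coe_sub (by rw [← NNReal.coe_le_coe]; push_cast; exact hsq'.le)]
    push_cast
    linarith
  obtain ⟨t, ht⟩ : ∃ t, 1 - δ < ex (law A₁ (attach R A₂) t)
      (fun g => ind (Correct g.1 g.2.1 g.2.2)) := by
    rw [← lt_iSup_iff, h.correct]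
    exact ENNReal.sub_lt_self (by simp) (by simp) hδ.ne'
  set μ := law A₁.record (attach R A₂.record) t with hμ
  have hbad : ex μ (fun g => ind (¬Correct g.1.1 g.2.1 g.2.2.1)) ≤ δ := by
    rw [← ex_law_forget t fun g => ind (Correct g.1 g.2.1 g.2.2)] at ht
    have hsum : ex μ (fun g => ind (¬Correct g.1.1 g.2.1 g.2.2.1)) +
        ex μ (fun g => ind (Correct g.1.1 g.2.1 g.2.2.1)) = 1 := by
      rw [← ex_add, ← ex_const μ 1]
      refine congrArg _ (funext fun g => ?_)
      by_cases hc : Correct g.1.1 g.2.1 g.2.2.1 <;> simp [ind, hc]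
    refine (ENNReal.add_le_add_iff_right (ex_ne_top μ fun g => ind_le_one _)).1
      (hsum.le.trans ?_)
    rw [add_comm]
    exact tsub_le_iff_right.1 ht.le
  have hV := h.state_uninformative hθ hno (hU t).1 fun z => ind (EQ z.1)
  have hg := h.prob_good t
  rw [← hμ] at hV hg
  -- When the execution is correct, `good` implies `EQ`, so `good` is covered by `EQ` together with
  -- `good`, or by an error. The next bound uses the converse implication.
  have hlow : θ ≤ ex μ (fun g => ind (EQ g.2.1) * ind (good g.1.1 g.2.2.1)) +
      ex μ (fun g => ind (¬Correct g.1.1 g.2.1 g.2.2.1)) := by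
    rw [← ex_add]
    nth_rewrite 1 [← hg]
    refine ex_mono fun g => ?_
    by_cases hc : Correct g.1.1 g.2.1 g.2.2.1
    · rw [← ind_and]
      exact (ind_mono fun hgood => ⟨(h.output _ _ _ hc hgood).2.1, hgood⟩).trans le_self_add
    · rw [ind_of hc]; exact (ind_le_one _).trans le_add_self
  have hup : ex μ (fun g => ind (EQ g.2.1)) ≤ θ + δ := by
    refine le_trans ?_ (add_le_add hg.le hbad)
    rw [← ex_add]
    refine ex_mono fun g => ?_
    by_cases hc : Correct g.1.1 g.2.1 g.2.2.1
    · exact (ind_mono (h.sound _ _ _ hc)).trans le_self_add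
    · rw [ind_of hc]; exact (ind_le_one _).trans le_add_self
  have : θ ≤ θ * θ + 2 * δ := by
    calc θ ≤ θ * ex μ (fun g => ind (EQ g.2.1)) + δ := by
          rw [← hV]; exact hlow.trans (by gcongr)
      _ ≤ θ * (θ + δ) + δ := by gcongr
      _ = θ * θ + (θ * δ + δ) := by ring
      _ ≤ θ * θ + (1 * δ + δ) := by gcongr
      _ = θ * θ + 2 * δ := by ring
  exact absurd this (not_le.2 hδ')

/-- From any reachable states satisfying `good`, correct outputs almost surely follow while `good`
persists. A larger probability of `good` thus becomes a larger probability of the output wanted by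
the deviator. -/
theorem exists_switch_of_gain (h : Setting A₁ A₂ R good Correct E₁ EQ E₂ θ)
    (hgain : ¬NoGain A₁ A₂ R good θ) :
    ∃ c z t, θ < ex (law A₁ ((attach R A₂.record).switch c z) t) fun g =>
      ind (c.length ≤ g.2.2.length) * ind (E₁ g.1 ∧ EQ g.2.1.1) := by
  unfold NoGain at hgain
  push Not at hgain
  obtain ⟨c, z, hz, hlt⟩ := hgain
  refine ⟨c, z, lt_ex_law_switch (E := fun s => E₁ s.1 ∧ EQ s.2.1) ?_ ?_ hz hlt⟩
  · rintro s s' hs ⟨h1, h2⟩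
    obtain ⟨h3, h4⟩ := round_ne_zero hs
    exact ⟨h.persist₁ _ _ _ h3 h1, h.persistQ _ _ _ (attach_step_ne_zero h4).1 h2⟩
  · intro t s hs hgood
    have hpc : Persistent A₁ (attach R A₂.record) fun g => Correct g.1 g.2.1 g.2.2.1 := by
      intro g g' hg hc
      obtain ⟨h3, h4⟩ := round_ne_zero hg
      obtain ⟨h5, h6⟩ := attach_step_ne_zero h4
      exact h.persist _ _ _ _ _ _ _ _ _ h3 h5 (record_step_ne_zero h6).1 hc
    have hpg : Persistent A₁ (attach R A₂.record) fun g => good g.1 g.2.2.1 := by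
      intro g g' hg hc
      obtain ⟨h3, h4⟩ := round_ne_zero hg
      obtain ⟨h5, h6⟩ := attach_step_ne_zero h4
      exact ((h.good₁ _ _ _ h3 _).trans (h.good₂ _ _ _ (record_step_ne_zero h6).1 _)).2 hc
    have h1 := iSup_run_eq_one hpc (by
      rw [← h.correct]
      exact iSup_congr fun t => ex_law_forget_right t fun g => ind (Correct g.1 g.2.1 g.2.2)) hs
    refine le_antisymm (iSup_le fun r => ex_le_one fun _ => ind_le_one _) ?_
    rw [← h1]
    refine iSup_mono fun r => ex_mono_support fun g hg => ind_mono fun hc => ?_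
    obtain ⟨h2, h3, -⟩ := h.output _ _ _ hc (run_persistent hpg hgood hg)
    exact ⟨h2, h3⟩

/-- One of the two outer parties can be exploited by someone who plays the other two. -/
theorem exists_profitable_switch (h : Setting A₁ A₂ R good Correct E₁ EQ E₂ θ)
    (h0 : θ ≠ 0) (h1 : θ < 1) :
    (∃ c z t, θ < ex (law A₁ ((attach R A₂.record).switch c z) t) fun g =>
      ind (c.length ≤ g.2.2.length) * ind (E₁ g.1 ∧ EQ g.2.1.1)) ∨
    ∃ c z t, θ < ex (law A₂ ((attach R.swap A₁.record).switch c z) t) fun g =>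
      ind (c.length ≤ g.2.2.length) * ind (E₂ g.1 ∧ EQ g.2.1.1) := by
  by_cases hno : NoGain A₁ A₂ R good θ
  · exact Or.inr (h.swap.exists_switch_of_gain fun hno' => h.not_noGain h0 h1 hno hno')
  · exact Or.inl (h.exists_switch_of_gain hno)

end Setting

end Setting

end Party

end

/-! ### One agent against the rest of a network, as two parties. -/

section

open Party

/-! ### A network seen from one agent as two parties -/

section Cast

variable {X M Y : Type}

/-- Equal strategies have the same states. -/
def castState {S S' : Strategy X M Y} (h : S = S') : S.State ≃ S'.State :=
  Equiv.cast (congrArg Strategy.State h)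

variable {S S' : Strategy X M Y} (h : S = S')

theorem msg_castState (s : S.State) : S'.msg (castState h s) = S.msg s := by subst h; rfl

theorem out_castState (s : S.State) : S'.out (castState h s) = S.out s := by subst h; rfl

theorem init_castState (i deg : ℕ) (x : X) :
    (S.init i deg x).map (castState h) = S'.init i deg x := by subst h; exact PMF.map_id _

theorem step_castState (s : S.State) (deg : ℕ) (r : Fin deg → M) :
    (S.step s deg r).map (castState h) = S'.step (castState h s) deg r := by
  subst h; exact PMF.map_id _

end Cast

/-- A network with a distinguished agent of degree `d`. -/
structure Rooted (d : ℕ) where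
  net : Network
  root : Fin net.n
  deg_root : net.deg root = d

namespace Rooted

variable {X M Y : Type} {d : ℕ} (N : Rooted d)

/-- The agents other than the distinguished one. -/
abbrev Other : Type := {v : Fin N.net.n // v ≠ N.root}

/-- The ports of the distinguished agent. -/
def port : Fin d ≃ N.net.G.neighborSet N.root :=
  (finCongr N.deg_root.symm).trans (N.net.port N.root)

/-- The agent behind a port of the distinguished agent. -/
def neighbor (i : Fin d) : N.Other := ⟨N.port i, ((N.port i).2 : N.net.G.Adj _ _).ne'⟩

theorem adj_neighbor (i : Fin d) : N.net.G.Adj (N.neighbor i) N.root :=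
  SimpleGraph.Adj.symm (N.port i).2

theorem adj_root {v : N.Other} {k : Fin (N.net.deg v)}
    (h : (N.net.port v k : Fin N.net.n) = N.root) :
    N.net.G.Adj N.root v := by
  have := (N.net.port v k).2
  rw [SimpleGraph.mem_neighborSet, h] at this
  exact this.symm

variable (Λ : Strategy X M Y)

/-- The messages that reach an agent if the distinguished agent sends `m`. -/
def incoming (s : N.Other → Λ.State) (m : Fin d → M) (v : N.Other) (k : Fin (N.net.deg v)) : M :=
  if h : (N.net.port v k : Fin N.net.n) = N.root then m (N.port.symm ⟨v, N.adj_root h⟩)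
  else Λ.msg (s ⟨N.net.port v k, h⟩)
    ((N.net.port (N.net.port v k)).symm ⟨v, SimpleGraph.Adj.symm (N.net.port v k).2⟩ : Fin _)

/-- All agents other than the distinguished one, executing the protocol `Λ`, as one party. -/
def others (x : Fin N.net.n → X) : Party (N.Other → Λ.State) (Fin d → M) (Fin d → M) where
  init := indep fun v => Λ.init (N.net.ident v) (N.net.deg v) (x v)
  out s i := Λ.msg (s (N.neighbor i))
    ((N.net.port (N.neighbor i)).symm ⟨N.root, N.adj_neighbor i⟩ : Fin _)
  step s m := indep fun v => Λ.step (s v) (N.net.deg v) (N.incoming Λ s m v)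

/-- A single agent as a party. -/
def _root_.KnowledgeSharing.Strategy.toParty (S : Strategy X M Y) (ident d : ℕ) (x : X) :
    Party S.State (Fin d → M) (Fin d → M) where
  init := S.init ident d x
  out s i := S.msg s i
  step s m := S.step s d m

variable {Λ} {S : Strategy X M Y} {prof : Fin N.net.n → Strategy X M Y}
  (hroot : prof N.root = S) (hother : ∀ v : N.Other, prof v = Λ)

/-- Split a configuration into the states of the other agents and that of the distinguished
agent. -/
def split : Config N.net prof ≃ (N.Other → Λ.State) × S.State where
  toFun c := (fun v => castState (hother v) (c v), castState hroot (c N.root))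
  invFun g v := if h : v = N.root then (castState (h ▸ hroot)).symm g.2
    else (castState (hother ⟨v, h⟩)).symm (g.1 ⟨v, h⟩)
  left_inv c := by
    funext v
    by_cases h : v = N.root
    · subst h; simp
    · simp [h]
  right_inv g := by
    refine Prod.ext (funext fun v => ?_) ?_
    · simp [v.2]
    · simp

theorem map_split (P : ∀ v, PMF (prof v).State) :
    (independent P).map (N.split hroot hother) =
      pmfProd (indep fun v : N.Other => (P v).map (castState (hother v)))
        ((P N.root).map (castState hroot)) := by
  ext g
  obtain ⟨c, rfl⟩ := (N.split hroot hother).surjective g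
  rw [map_equiv_apply, Equiv.symm_apply_apply, independent_apply, pmfProd_apply, indep_apply]
  simp only [split, Equiv.coe_fn_mk, map_equiv_apply, Equiv.symm_apply_apply]
  rw [mul_comm]
  exact Fintype.prod_eq_mul_prod_subtype_ne (fun v => P v (c v)) N.root

theorem received_root (c : Config N.net prof) (x : Fin N.net.n → X) :
    (fun i : Fin d => received N.net c N.root (Fin.cast N.deg_root.symm i)) =
      (N.others Λ x).out (N.split hroot hother c).1 := by
  funext i
  simp only [others, split, Equiv.coe_fn_mk, msg_castState]
  rfl

theorem received_other (c : Config N.net prof) (i : ℕ) (y : X) (v : N.Other) :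
    received N.net c v = N.incoming Λ (N.split hroot hother c).1
      ((S.toParty i d y).out (N.split hroot hother c).2) v := by
  funext k
  -- The neighbour is generalised to a variable `w` so that it can be replaced by the root despite
  -- the types depending on it.
  have key : ∀ w (hw : N.net.G.Adj w v) (hw' : N.net.G.Adj N.root v), w = N.root →
      (prof w).msg (c w) ((N.net.port w).symm ⟨v, hw⟩ : Fin _) =
        S.msg (castState hroot (c N.root)) (N.port.symm ⟨v, hw'⟩ : Fin _) := by
    rintro w hw hw' rfl
    rw [msg_castState]
    rfl
  by_cases h : (N.net.port v k : Fin N.net.n) = N.root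
  · simp only [received, incoming, h, dite_true]
    exact key _ _ _ h
  · simp only [received, incoming, h, dite_false, split, Equiv.coe_fn_mk, msg_castState]

theorem _root_.KnowledgeSharing.Strategy.step_of_eq (S : Strategy X M Y) {n n' : ℕ} (h : n = n')
    (s : S.State)
    (r : Fin n → M) : S.step s n r = S.step s n' fun i => r (Fin.cast h.symm i) := by
  subst h; rfl

/-- All agents step independently given the messages, so grouping those other than the root into one
party leaves a two-party execution with one message per port of the root. -/
theorem configLaw_split (x : Fin N.net.n → X) (t : ℕ) :
    (configLaw N.net prof x t).map (N.split hroot hother) =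
      law (N.others Λ x) (S.toParty (N.net.ident N.root) d (x N.root)) t := by
  induction t with
  | zero =>
    rw [configLaw, law, map_split]
    simp only [init_castState, others, Strategy.toParty, N.deg_root]
  | succ t ih =>
    rw [configLaw, law, ← ih, PMF.map_bind, PMF.bind_map]
    congr 1
    funext c
    rw [map_split, Function.comp_apply, Party.round]
    congr 1
    · simp only [step_castState]
      simp only [received_other N hroot hother c (N.net.ident N.root) (x N.root)]
      rfl
    · rw [step_castState, S.step_of_eq N.deg_root, N.received_root hroot hother c x]
      rfl

theorem others_congr {x x' : Fin N.net.n → X} (h : ∀ v : N.Other, x v = x' v) :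
    N.others Λ x = N.others Λ x' := by
  simp only [others, h]

theorem join_eq_some_iff (o : Option (Option Y)) (p : Y) : o.join = some p ↔ o = some (some p) := by
  rcases o with _ | _ | y <;> simp

theorem utility_outputs (c : Config N.net prof) (p : Y) :
    utility N.root p (outputs N.net c) =
      ind ((∀ v, Λ.out ((N.split hroot hother c).1 v) = some (some p)) ∧
        S.out (N.split hroot hother c).2 = some (some p)) := by
  suffices key : (outputs N.net c N.root = some p ∧ Legal (outputs N.net c)) ↔
      (∀ v, Λ.out ((N.split hroot hother c).1 v) = some (some p)) ∧
        S.out (N.split hroot hother c).2 = some (some p) by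
    unfold utility
    rw [← ind_congr key]
    split_ifs with h
    · exact (ind_of h).symm
    · exact (ind_of_not h).symm
  simp only [split, Equiv.coe_fn_mk, out_castState, outputs, join_eq_some_iff, Legal]
  constructor
  · rintro ⟨h1, h2⟩
    refine ⟨fun v => ?_, h1⟩
    have := (h2 v N.root).1
    rw [h1] at this
    exact (join_eq_some_iff _ _).1 this
  · rintro ⟨h1, h2⟩
    have : ∀ v, ((prof v).out (c v)).join = some p := fun v => by
      by_cases h : v = N.root
      · subst h; rw [h2]; rfl
      · rw [h1 ⟨v, h⟩]; rfl
    exact ⟨h2, fun a b => ⟨by rw [this a, this b], by simp [this a]⟩⟩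

/-- The utility of the distinguished agent in terms of the two parties. -/
theorem runUtility_eq (Λ S : Strategy X M Y) (p : Y) (x : Fin N.net.n → X) (i : X) :
    runUtility N.net (Function.update (fun _ => Λ) N.root S) N.root p
        (Function.update x N.root i) =
      ⨆ t, ex (law (N.others Λ x) (S.toParty (N.net.ident N.root) d i) t) fun g =>
        ind ((∀ v, Λ.out (g.1 v) = some (some p)) ∧ S.out g.2 = some (some p)) := by
  have hroot : Function.update (fun _ => Λ) N.root S N.root = S := Function.update_self _ _ _
  have hother : ∀ v : N.Other, Function.update (fun _ => Λ) N.root S v = Λ := fun v =>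
    Function.update_of_ne v.2 _ _
  unfold runUtility
  refine iSup_congr fun t => ?_
  have h1 := N.configLaw_split hroot hother (Function.update x N.root i) t
  -- The other agents never read the root's input, so its update affects only the single-agent
  -- party.
  rw [Function.update_self, N.others_congr (x' := x) fun v => Function.update_of_ne v.2 _ _] at h1
  rw [← h1, ex_map]
  exact tsum_congr fun c => by rw [N.utility_outputs hroot hother c p]

end Rooted

end

/-! ### Transfer to networks with vertex set `Fin n`. -/

section

open Party

/-! ### Networks on arbitrary finite vertex types -/

/-- A graph with numbered edges, given by the edges at each vertex and their other ends. -/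
structure LocalGraph (W : Type) where
  Nb : W → Type
  dir : ∀ w, Nb w → W
  dir_injective : ∀ w, Function.Injective (dir w)
  dir_ne : ∀ w k, dir w k ≠ w
  dir_symm : ∀ w k, ∃ k', dir (dir w k) k' = w
  deg : W → ℕ
  port : ∀ w, Fin (deg w) ≃ Nb w

namespace LocalGraph

variable {W : Type} (J : LocalGraph W)

/-- The underlying simple graph. -/
def graph : SimpleGraph W where
  Adj w w' := ∃ k, J.dir w k = w'
  symm := ⟨by
    rintro w _ ⟨k, rfl⟩
    exact J.dir_symm w k⟩
  loopless := ⟨fun w ⟨k, hk⟩ => J.dir_ne w k hk⟩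

/-- The edges at a vertex correspond to its neighbours. -/
def nbEquiv (w : W) : J.Nb w ≃ J.graph.neighborSet w :=
  Equiv.ofBijective (fun k => ⟨J.dir w k, k, rfl⟩)
    ⟨fun k k' h => J.dir_injective w (congrArg Subtype.val h), by
      rintro ⟨_, k, rfl⟩
      exact ⟨k, rfl⟩⟩

variable {X M Y : Type} (Λ : Strategy X M Y)

/-- The messages that reach a vertex. -/
def incoming (c : W → Λ.State) (w : W) (k : Fin (J.deg w)) : M :=
  Λ.msg (c (J.dir w (J.port w k)))
    ((J.port _).symm (Classical.choose (J.dir_symm w (J.port w k))) : Fin _)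

/-- The return edge in `incoming` is chosen arbitrarily, but it is unique because edges at a vertex
have distinct ends. Any explicit return edge may therefore be used. -/
theorem incoming_eq (c : W → Λ.State) {w w' : W} {k : Fin (J.deg w)} (h : J.dir w (J.port w k) = w')
    {k' : J.Nb w'} (hk' : J.dir w' k' = w) :
    J.incoming Λ c w k = Λ.msg (c w') ((J.port w').symm k' : Fin _) := by
  subst h
  unfold incoming
  have : Classical.choose (J.dir_symm w (J.port w k)) = k' :=
    J.dir_injective _ ((Classical.choose_spec (J.dir_symm w (J.port w k))).trans hk'.symm)
  rw [this]

variable [Fintype W] (ident : W → ℕ) (hident : Function.Injective ident)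

/-- The network with vertices labelled by `Fin n`. -/
abbrev net : Network where
  n := Fintype.card W
  G := J.graph.comap (Fintype.equivFin W).symm
  deg u := J.deg ((Fintype.equivFin W).symm u)
  port u := (J.port _).trans ((J.nbEquiv _).trans
    { toFun := fun w => ⟨Fintype.equivFin W w.1, by
        change J.graph.Adj _ ((Fintype.equivFin W).symm (Fintype.equivFin W w.1))
        rw [Equiv.symm_apply_apply]
        exact w.2⟩
      invFun := fun v => ⟨(Fintype.equivFin W).symm v.1, v.2⟩
      left_inv := fun w => by simp
      right_inv := fun v => by simp })
  ident u := ident ((Fintype.equivFin W).symm u)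
  ident_injective := hident.comp (Fintype.equivFin W).symm.injective

theorem net_port_symm (u u' : Fin (J.net ident hident).n)
    (hu : (J.net ident hident).G.Adj u' u) {w' : W} (hw' : (Fintype.equivFin W).symm u' = w')
    {k' : J.Nb w'} (hk' : J.dir w' k' = (Fintype.equivFin W).symm u) :
    ((((J.net ident hident).port u').symm ⟨u, hu⟩ : Fin _) : ℕ) =
      ((J.port w').symm k' : Fin _) := by
  subst hw'
  congr 1
  rw [Equiv.symm_apply_eq]
  refine Subtype.ext ?_
  simp only [Equiv.trans_apply, Equiv.coe_fn_mk, Equiv.apply_symm_apply]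
  change u = Fintype.equivFin W (J.dir _ k')
  rw [hk', Equiv.apply_symm_apply]

theorem received_net (c : Fin (J.net ident hident).n → Λ.State) (u : Fin (J.net ident hident).n) :
    received (J.net ident hident) (prof := fun _ => Λ) c u =
      J.incoming Λ (fun w => c (Fintype.equivFin W w)) ((Fintype.equivFin W).symm u) := by
  funext k
  unfold received incoming
  simp only []
  congr 1
  exact J.net_port_symm ident hident u _ _ (Equiv.symm_apply_apply _ _)
    (Classical.choose_spec (J.dir_symm _ (J.port _ k)))

/-- The law of the configuration after `t` rounds, with vertices in `W`. -/
def vertexLaw (x : W → X) : ℕ → PMF (W → Λ.State)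
  | 0 => indep fun w => Λ.init (ident w) (J.deg w) (x w)
  | t + 1 => (vertexLaw x t).bind fun c => indep fun w => Λ.step (c w) (J.deg w) (J.incoming Λ c w)

theorem map_independent_equivFin {Z : Type} (P : W → PMF Z) :
    (independent fun u => P ((Fintype.equivFin W).symm u)).map
      (fun c w => c (Fintype.equivFin W w)) = indep P := by
  ext c
  have := map_equiv_apply (independent fun u => P ((Fintype.equivFin W).symm u))
    (Equiv.arrowCongr (Fintype.equivFin W).symm (Equiv.refl Z)) c
  refine Eq.trans ?_ (this.trans ?_)
  · rfl
  · rw [independent_apply, indep_apply]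
    exact Fintype.prod_equiv (Fintype.equivFin W).symm _ _ fun k => by simp

theorem configLaw_net (x : W → X) (t : ℕ) :
    (configLaw (J.net ident hident) (fun _ => Λ) (fun u => x ((Fintype.equivFin W).symm u)) t).map
      (fun c w => c (Fintype.equivFin W w)) = J.vertexLaw Λ ident x t := by
  induction t with
  | zero =>
    rw [configLaw, vertexLaw]
    exact map_independent_equivFin fun w => Λ.init (ident w) (J.deg w) (x w)
  | succ t ih =>
    rw [configLaw, vertexLaw, ← ih, PMF.map_bind, PMF.bind_map]
    congr 1
    funext c
    refine Eq.trans ?_ (map_independent_equivFin fun w => Λ.step (c (Fintype.equivFin W w))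
      (J.deg w) (J.incoming Λ (fun w => c (Fintype.equivFin W w)) w))
    congr 2
    funext u
    rw [J.received_net Λ ident hident c u, Equiv.apply_symm_apply]

/-- A set with subsingleton complement is everything or everything but one vertex, so one condition
covers both connectivity requirements. -/
theorem twoConnected_net (h3 : 3 ≤ Fintype.card W)
    (h : ∀ s : Set W, sᶜ.Subsingleton → (J.graph.induce s).Connected) :
    TwoConnected (J.net ident hident).G := by
  refine ⟨h3, ?_, fun v => ?_⟩
  · have h1 := (SimpleGraph.induceUnivIso J.graph).connected_iff.1
      (h Set.univ (by simp))
    exact (SimpleGraph.Iso.comap (Fintype.equivFin W).symm J.graph).connected_iff.2 h1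
  · have h1 := h {(Fintype.equivFin W).symm v}ᶜ (by simp)
    let e : (J.net ident hident).G.induce {v}ᶜ ≃g J.graph.induce {(Fintype.equivFin W).symm v}ᶜ :=
      { toEquiv := (Fintype.equivFin W).symm.subtypeEquiv fun u =>
          not_congr (Fintype.equivFin W).symm.injective.eq_iff.symm
        map_rel_iff' := Iff.rfl }
    exact e.connected_iff.2 h1

end LocalGraph

end

/-! ### Construction of the joined network and its decomposition. -/

section

open Party

/-! ### Joining two networks through a complete graph -/

section Middle

variable {X M Y : Type} {d L : ℕ}

/-- The vertices of the middle part. The vertex `inl i` is joined to the agents behind the `i`-th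
ports of the two distinguished agents. -/
abbrev Mid (d L : ℕ) : Type := Fin d ⊕ Fin L

/-- The edges at a vertex of the middle part. -/
abbrev MidNb (r : Mid d L) : Type :=
  {r' : Mid d L // r' ≠ r} ⊕ {p : Bool × Fin d // Sum.inl p.2 = r}

/-- The degree of a vertex of the middle part. -/
def midDeg (r : Mid d L) : ℕ := Fintype.card (MidNb r)

/-- The port numbering of the middle part. -/
def midPort (r : Mid d L) : Fin (midDeg r) ≃ MidNb r := (Fintype.equivFin (MidNb r)).symm

/-- The identifiers of the middle part. -/
def midIdent (r : Mid d L) : ℕ := 3 * (finSumFinEquiv r : ℕ)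

variable (Λ : Strategy X M Y)

/-- The messages that reach a vertex of the middle part. -/
def midIncoming (s : Mid d L → Λ.State) (m : (Fin d → M) × (Fin d → M)) (r : Mid d L)
    (k : Fin (midDeg r)) : M :=
  match midPort r k with
  | Sum.inl r' => Λ.msg (s r') ((midPort r'.1).symm (Sum.inl ⟨r, r'.2.symm⟩) : Fin _)
  | Sum.inr p => bif p.1.1 then m.1 p.1.2 else m.2 p.1.2

/-- The message that the middle part sends through a port of a distinguished agent. -/
def midSend (s : Mid d L → Λ.State) (b : Bool) (i : Fin d) : M :=
  Λ.msg (s (Sum.inl i)) ((midPort (Sum.inl i : Mid d L)).symm (Sum.inr ⟨(b, i), rfl⟩) : Fin _)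

/-- The middle part, executing the protocol `Λ` with all inputs equal to `x₀`. -/
def middle (d L : ℕ) (x₀ : X) :
    Party (Mid d L → Λ.State) ((Fin d → M) × (Fin d → M)) ((Fin d → M) × (Fin d → M)) where
  init := indep fun r => Λ.init (midIdent r) (midDeg r) x₀
  out s := (midSend Λ s true, midSend Λ s false)
  step s m := indep fun r => Λ.step (s r) (midDeg r) (midIncoming Λ s m r)

end Middle

namespace Rooted

variable {d : ℕ} {W : Type}

/-- Redirect the edges to the distinguished agent. -/
def dir (N : Rooted d) (f : N.Other → W) (g : Fin d → W) (v : N.Other)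
    (u : N.net.G.neighborSet v) : W :=
  if h : (u : Fin N.net.n) = N.root then g (N.port.symm ⟨v, by
    have := u.2; rw [SimpleGraph.mem_neighborSet, h] at this; exact this.symm⟩)
  else f ⟨u, h⟩

theorem port_symm_neighbor (N : Rooted d) (i : Fin d) (h) :
    N.port.symm ⟨N.neighbor i, h⟩ = i := by
  rw [Equiv.symm_apply_eq]; rfl

theorem neighbor_port_symm (N : Rooted d) (v : N.Other) (h) :
    N.neighbor (N.port.symm ⟨v, h⟩) = v := by
  refine Subtype.ext ?_
  change ((N.port (N.port.symm ⟨v, h⟩) : N.net.G.neighborSet N.root) : Fin N.net.n) = v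
  rw [Equiv.apply_symm_apply]

theorem dir_root (N : Rooted d) (f : N.Other → W) (g : Fin d → W) (i : Fin d) :
    N.dir f g (N.neighbor i) ⟨N.root, N.adj_neighbor i⟩ = g i := by
  unfold dir
  rw [dif_pos rfl]
  exact congrArg g (N.port_symm_neighbor i _)

theorem dir_injective (N : Rooted d) {f : N.Other → W} {g : Fin d → W}
    (hf : Function.Injective f) (hfg : ∀ v i, f v ≠ g i) (v : N.Other) :
    Function.Injective (N.dir f g v) := by
  rintro ⟨u, hu⟩ ⟨u', hu'⟩ h
  unfold dir at h
  refine Subtype.ext ?_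
  simp only at h ⊢
  split_ifs at h with h1 h2 h2
  · rw [h1, h2]
  · exact (hfg _ _ h.symm).elim
  · exact (hfg _ _ h).elim
  · exact congrArg Subtype.val (hf h)

end Rooted

section Join

variable {X M Y : Type} {d : ℕ} (N₁ N₂ : Rooted d) (L : ℕ)

/-- The vertices of the joined network. -/
abbrev JoinVertex : Type := Mid d L ⊕ (N₁.Other ⊕ N₂.Other)

/-- The edges of the middle part in the joined network. -/
def midDir (r : Mid d L) : MidNb r → JoinVertex N₁ N₂ L
  | Sum.inl r' => Sum.inl r'.1
  | Sum.inr p =>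
    Sum.inr (bif p.1.1 then Sum.inl (N₁.neighbor p.1.2) else Sum.inr (N₂.neighbor p.1.2))

theorem Rooted.neighbor_injective {d : ℕ} (N : Rooted d) : Function.Injective N.neighbor := by
  intro i j h
  have h' : ((N.neighbor i : N.Other) : Fin N.net.n) = N.neighbor j := congrArg Subtype.val h
  exact N.port.injective (Subtype.ext h')

theorem midDir_injective (r : Mid d L) : Function.Injective (midDir N₁ N₂ L r) := by
  rintro (⟨r', hr'⟩ | ⟨⟨_ | _, i⟩, hi⟩) (⟨r'', hr''⟩ | ⟨⟨_ | _, j⟩, hj⟩) h <;>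
    simp only [midDir, cond_true, cond_false, Sum.inl.injEq, Sum.inr.injEq, reduceCtorEq] at h
  · subst h; rfl
  · obtain rfl := N₂.neighbor_injective h; rfl
  · obtain rfl := N₁.neighbor_injective h; rfl

/-- The edges at a vertex of the joined network. -/
def JoinNb : JoinVertex N₁ N₂ L → Type
  | Sum.inl r => MidNb r
  | Sum.inr (Sum.inl v) => N₁.net.G.neighborSet v
  | Sum.inr (Sum.inr v) => N₂.net.G.neighborSet v

/-- The other ends of the edges of the joined network. -/
def joinDir : ∀ w, JoinNb N₁ N₂ L w → JoinVertex N₁ N₂ L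
  | Sum.inl r => midDir N₁ N₂ L r
  | Sum.inr (Sum.inl v) =>
    N₁.dir (fun v => Sum.inr (Sum.inl v)) (fun i => Sum.inl (Sum.inl i)) v
  | Sum.inr (Sum.inr v) =>
    N₂.dir (fun v => Sum.inr (Sum.inr v)) (fun i => Sum.inl (Sum.inl i)) v

theorem joinDir_left_root (v : N₁.Other) (u : N₁.net.G.neighborSet v)
    (h : (u : Fin N₁.net.n) = N₁.root) : ∃ i, v = N₁.neighbor i ∧
      joinDir N₁ N₂ L (Sum.inr (Sum.inl v)) u = Sum.inl (Sum.inl i) :=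
  ⟨_, (N₁.neighbor_port_symm v (by
    have := u.2; rw [SimpleGraph.mem_neighborSet, h] at this; exact this.symm)).symm, dif_pos h⟩

theorem joinDir_right_root (v : N₂.Other) (u : N₂.net.G.neighborSet v)
    (h : (u : Fin N₂.net.n) = N₂.root) : ∃ i, v = N₂.neighbor i ∧
      joinDir N₁ N₂ L (Sum.inr (Sum.inr v)) u = Sum.inl (Sum.inl i) :=
  ⟨_, (N₂.neighbor_port_symm v (by
    have := u.2; rw [SimpleGraph.mem_neighborSet, h] at this; exact this.symm)).symm, dif_pos h⟩

theorem joinDir_left (v : N₁.Other) (u : N₁.net.G.neighborSet v)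
    (h : (u : Fin N₁.net.n) ≠ N₁.root) :
    joinDir N₁ N₂ L (Sum.inr (Sum.inl v)) u = Sum.inr (Sum.inl ⟨u, h⟩) := dif_neg h

theorem joinDir_right (v : N₂.Other) (u : N₂.net.G.neighborSet v)
    (h : (u : Fin N₂.net.n) ≠ N₂.root) :
    joinDir N₁ N₂ L (Sum.inr (Sum.inr v)) u = Sum.inr (Sum.inr ⟨u, h⟩) := dif_neg h

theorem joinDir_left_neighbor (i : Fin d) :
    joinDir N₁ N₂ L (Sum.inr (Sum.inl (N₁.neighbor i))) ⟨N₁.root, N₁.adj_neighbor i⟩ =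
      Sum.inl (Sum.inl i) :=
  N₁.dir_root (fun v => Sum.inr (Sum.inl v)) (fun i => Sum.inl (Sum.inl i)) i

theorem joinDir_right_neighbor (i : Fin d) :
    joinDir N₁ N₂ L (Sum.inr (Sum.inr (N₂.neighbor i))) ⟨N₂.root, N₂.adj_neighbor i⟩ =
      Sum.inl (Sum.inl i) :=
  N₂.dir_root (fun v => Sum.inr (Sum.inr v)) (fun i => Sum.inl (Sum.inl i)) i

/-- The joined network: the two distinguished agents are removed, and their ports are connected
to a complete graph. -/
def join : LocalGraph (JoinVertex N₁ N₂ L) where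
  Nb := JoinNb N₁ N₂ L
  dir := joinDir N₁ N₂ L
  dir_injective := by
    rintro (r | v | v)
    · exact midDir_injective N₁ N₂ L r
    · exact N₁.dir_injective (Sum.inr_injective.comp Sum.inl_injective)
        (fun _ _ h => Sum.inr_ne_inl h) v
    · exact N₂.dir_injective (Sum.inr_injective.comp Sum.inr_injective)
        (fun _ _ h => Sum.inr_ne_inl h) v
  dir_ne := by
    rintro (r | v | v) k
    · rcases k with ⟨r', hr'⟩ | ⟨⟨b, i⟩, hi⟩
      · simpa [joinDir, midDir] using hr'
      · simp [joinDir, midDir]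
    · by_cases h : (k.1 : Fin N₁.net.n) = N₁.root
      · obtain ⟨i, -, hi⟩ := joinDir_left_root N₁ N₂ L v k h
        simp [hi]
      · rw [joinDir_left N₁ N₂ L v k h]
        intro h'
        simp only [Sum.inr.injEq, Sum.inl.injEq] at h'
        exact (k.2 : N₁.net.G.Adj _ _).ne (congrArg Subtype.val h').symm
    · by_cases h : (k.1 : Fin N₂.net.n) = N₂.root
      · obtain ⟨i, -, hi⟩ := joinDir_right_root N₁ N₂ L v k h
        simp [hi]
      · rw [joinDir_right N₁ N₂ L v k h]
        intro h'
        simp only [Sum.inr.injEq] at h'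
        exact (k.2 : N₂.net.G.Adj _ _).ne (congrArg Subtype.val h').symm
  dir_symm := by
    rintro (r | v | v) k
    · rcases k with ⟨r', hr'⟩ | ⟨⟨_ | _, i⟩, rfl⟩
      · exact ⟨Sum.inl ⟨r, hr'.symm⟩, rfl⟩
      · exact ⟨⟨N₂.root, N₂.adj_neighbor i⟩, joinDir_right_neighbor N₁ N₂ L i⟩
      · exact ⟨⟨N₁.root, N₁.adj_neighbor i⟩, joinDir_left_neighbor N₁ N₂ L i⟩
    · by_cases h : (k.1 : Fin N₁.net.n) = N₁.root
      · obtain ⟨i, rfl, hi⟩ := joinDir_left_root N₁ N₂ L v k h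
        rw [hi]
        exact ⟨Sum.inr ⟨(true, i), rfl⟩, rfl⟩
      · rw [joinDir_left N₁ N₂ L v k h]
        exact ⟨⟨v, SimpleGraph.Adj.symm k.2⟩, joinDir_left N₁ N₂ L ⟨k.1, h⟩ ⟨v, _⟩ v.2⟩
    · by_cases h : (k.1 : Fin N₂.net.n) = N₂.root
      · obtain ⟨i, rfl, hi⟩ := joinDir_right_root N₁ N₂ L v k h
        rw [hi]
        exact ⟨Sum.inr ⟨(false, i), rfl⟩, rfl⟩
      · rw [joinDir_right N₁ N₂ L v k h]
        exact ⟨⟨v, SimpleGraph.Adj.symm k.2⟩, joinDir_right N₁ N₂ L ⟨k.1, h⟩ ⟨v, _⟩ v.2⟩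
  deg
    | Sum.inl r => midDeg r
    | Sum.inr (Sum.inl v) => N₁.net.deg v
    | Sum.inr (Sum.inr v) => N₂.net.deg v
  port
    | Sum.inl r => midPort r
    | Sum.inr (Sum.inl v) => N₁.net.port v
    | Sum.inr (Sum.inr v) => N₂.net.port v

/-- The identifiers of the joined network. -/
def joinIdent : JoinVertex N₁ N₂ L → ℕ
  | Sum.inl r => midIdent r
  | Sum.inr (Sum.inl v) => N₁.net.ident v
  | Sum.inr (Sum.inr v) => N₂.net.ident v

/-- The three parts use the three residue classes mod 3. The middle may use the identifier 0 of the
distinguished agents, because these have been removed. -/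
theorem joinIdent_injective (h₁ : ∀ v : N₁.Other, N₁.net.ident v % 3 = 1)
    (h₂ : ∀ v : N₂.Other, N₂.net.ident v % 3 = 2) :
    Function.Injective (joinIdent N₁ N₂ L) := by
  have h0 : ∀ r : Mid d L, midIdent r % 3 = 0 := fun r => by simp [midIdent]
  rintro (r | v | v) (r' | v' | v') h <;> simp only [joinIdent] at h
  · have : finSumFinEquiv r = finSumFinEquiv r' := Fin.ext (by unfold midIdent at h; omega)
    rw [finSumFinEquiv.injective this]
  · have := h0 r; have := h₁ v'; omega
  · have := h0 r; have := h₂ v'; omega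
  · have := h0 r'; have := h₁ v; omega
  · rw [Subtype.ext (N₁.net.ident_injective h)]
  · have := h₁ v; have := h₂ v'; omega
  · have := h0 r'; have := h₂ v; omega
  · have := h₁ v'; have := h₂ v; omega
  · rw [Subtype.ext (N₂.net.ident_injective h)]

variable (Λ : Strategy X M Y)

/-- The inputs of the joined network. -/
def joinInput (x₀ : X) (x₁ : Fin N₁.net.n → X) (x₂ : Fin N₂.net.n → X) :
    JoinVertex N₁ N₂ L → X
  | Sum.inl _ => x₀
  | Sum.inr (Sum.inl v) => x₁ v
  | Sum.inr (Sum.inr v) => x₂ v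

/-- Split a configuration of the joined network into its three parts. -/
def joinSplit {Z : Type} : (JoinVertex N₁ N₂ L → Z) ≃
    (N₁.Other → Z) × ((Mid d L → Z) × (N₂.Other → Z)) where
  toFun c := (fun v => c (Sum.inr (Sum.inl v)), (fun r => c (Sum.inl r),
    fun v => c (Sum.inr (Sum.inr v))))
  invFun g := Sum.elim g.2.1 (Sum.elim g.1 g.2.2)
  left_inv c := by funext w; rcases w with r | v | v <;> rfl
  right_inv _ := rfl

theorem map_joinSplit {Z : Type} (P : JoinVertex N₁ N₂ L → PMF Z) :
    (indep P).map (joinSplit N₁ N₂ L) =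
      pmfProd (indep fun v => P (Sum.inr (Sum.inl v)))
        (pmfProd (indep fun r => P (Sum.inl r)) (indep fun v => P (Sum.inr (Sum.inr v)))) := by
  ext g
  obtain ⟨c, rfl⟩ := (joinSplit N₁ N₂ L).surjective g
  rw [map_equiv_apply, Equiv.symm_apply_apply]
  simp only [pmfProd_apply, indep_apply]
  rw [mul_left_comm]
  refine (Fintype.prod_sum_type fun w => P w (c w)).trans ?_
  exact congrArg _ (Fintype.prod_sum_type fun w => P (Sum.inr w) (c (Sum.inr w)))

variable (c : JoinVertex N₁ N₂ L → Λ.State)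

theorem join_incoming_left (x₀ : X) (v : N₁.Other) :
    (join N₁ N₂ L).incoming Λ c (Sum.inr (Sum.inl v)) =
      N₁.incoming Λ (fun v => c (Sum.inr (Sum.inl v)))
        ((middle Λ d L x₀).out fun r => c (Sum.inl r)).1 v := by
  funext k
  change Fin (N₁.net.deg v) at k
  unfold Rooted.incoming
  by_cases h : (N₁.net.port v k : Fin N₁.net.n) = N₁.root
  · rw [dif_pos h]
    refine (join N₁ N₂ L).incoming_eq Λ c (w := Sum.inr (Sum.inl v)) (k := k)
      (w' := Sum.inl (Sum.inl (N₁.port.symm ⟨v, N₁.adj_root h⟩)))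
      (k' := Sum.inr ⟨(true, _), rfl⟩) ?_ ?_
    · exact dif_pos h
    · exact congrArg (fun v => Sum.inr (Sum.inl v)) (N₁.neighbor_port_symm v _)
  · rw [dif_neg h]
    exact (join N₁ N₂ L).incoming_eq Λ c (w := Sum.inr (Sum.inl v)) (k := k)
      (w' := Sum.inr (Sum.inl ⟨N₁.net.port v k, h⟩))
      (k' := ⟨v, SimpleGraph.Adj.symm (N₁.net.port v k).2⟩) 
      (joinDir_left N₁ N₂ L v (N₁.net.port v k) h) (joinDir_left N₁ N₂ L _ ⟨v, _⟩ v.2)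

theorem join_incoming_right (x₀ : X) (v : N₂.Other) :
    (join N₁ N₂ L).incoming Λ c (Sum.inr (Sum.inr v)) =
      N₂.incoming Λ (fun v => c (Sum.inr (Sum.inr v)))
        ((middle Λ d L x₀).out fun r => c (Sum.inl r)).2 v := by
  funext k
  change Fin (N₂.net.deg v) at k
  unfold Rooted.incoming
  by_cases h : (N₂.net.port v k : Fin N₂.net.n) = N₂.root
  · rw [dif_pos h]
    refine (join N₁ N₂ L).incoming_eq Λ c (w := Sum.inr (Sum.inr v)) (k := k)
      (w' := Sum.inl (Sum.inl (N₂.port.symm ⟨v, N₂.adj_root h⟩)))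
      (k' := Sum.inr ⟨(false, _), rfl⟩) ?_ ?_
    · exact dif_pos h
    · exact congrArg (fun v => Sum.inr (Sum.inr v)) (N₂.neighbor_port_symm v _)
  · rw [dif_neg h]
    exact (join N₁ N₂ L).incoming_eq Λ c (w := Sum.inr (Sum.inr v)) (k := k)
      (w' := Sum.inr (Sum.inr ⟨N₂.net.port v k, h⟩))
      (k' := ⟨v, SimpleGraph.Adj.symm (N₂.net.port v k).2⟩) 
      (joinDir_right N₁ N₂ L v (N₂.net.port v k) h) (joinDir_right N₁ N₂ L _ ⟨v, _⟩ v.2)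

theorem join_incoming_mid (x₁ : Fin N₁.net.n → X) (x₂ : Fin N₂.net.n → X) (r : Mid d L) :
    (join N₁ N₂ L).incoming Λ c (Sum.inl r) =
      midIncoming Λ (fun r => c (Sum.inl r))
        ((N₁.others Λ x₁).out (fun v => c (Sum.inr (Sum.inl v))),
          (N₂.others Λ x₂).out (fun v => c (Sum.inr (Sum.inr v)))) r := by
  funext k
  change Fin (midDeg r) at k
  unfold midIncoming
  rcases hk : midPort r k with r' | ⟨⟨_ | _, i⟩, rfl⟩
  · exact (join N₁ N₂ L).incoming_eq Λ c (w' := Sum.inl r'.1) (k' := Sum.inl ⟨r, r'.2.symm⟩)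
      (by change midDir N₁ N₂ L r (midPort r k) = _; rw [hk]; rfl) rfl
  · exact (join N₁ N₂ L).incoming_eq Λ c (w' := Sum.inr (Sum.inr (N₂.neighbor i)))
      (k' := ⟨N₂.root, N₂.adj_neighbor i⟩)
      (by change midDir N₁ N₂ L _ (midPort _ k) = _; rw [hk]; rfl)
      (joinDir_right_neighbor N₁ N₂ L i)
  · exact (join N₁ N₂ L).incoming_eq Λ c (w' := Sum.inr (Sum.inl (N₁.neighbor i)))
      (k' := ⟨N₁.root, N₁.adj_neighbor i⟩)
      (by change midDir N₁ N₂ L _ (midPort _ k) = _; rw [hk]; rfl) (joinDir_left_neighbor N₁ N₂ L i)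

/-- Agents of the halves keep their ports, degrees and identifiers; only what lies behind the ports
to the removed agents changes. The joined network is thus exactly a row of three parties. -/
theorem vertexLaw_join (x₀ : X) (x₁ : Fin N₁.net.n → X) (x₂ : Fin N₂.net.n → X) (t : ℕ) :
    ((join N₁ N₂ L).vertexLaw Λ (joinIdent N₁ N₂ L) (joinInput N₁ N₂ L x₀ x₁ x₂) t).map
        (joinSplit N₁ N₂ L) =
      law (N₁.others Λ x₁) (attach (middle Λ d L x₀) (N₂.others Λ x₂)) t := by
  induction t with
  | zero =>
    rw [LocalGraph.vertexLaw, map_joinSplit]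
    rfl
  | succ t ih =>
    rw [LocalGraph.vertexLaw, law, ← ih, PMF.map_bind, PMF.bind_map]
    congr 1
    funext c
    rw [map_joinSplit, Function.comp_apply, Party.round]
    simp only [join_incoming_left N₁ N₂ L Λ c x₀, join_incoming_right N₁ N₂ L Λ c x₀,
      join_incoming_mid N₁ N₂ L Λ c x₁ x₂]
    rfl

end Join

end

/-! ### Connectivity of the joined network, and balanced counting. -/

section

open Party

/-! ### The joined network is 2-connected -/

theorem TwoConnected.induce_connected {n : ℕ} {G : SimpleGraph (Fin n)} (h : TwoConnected G)
    {t : Set (Fin n)} (ht : tᶜ.Subsingleton) : (G.induce t).Connected := by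
  rcases ht.eq_empty_or_singleton with h0 | ⟨v, hv⟩
  · rw [Set.compl_empty_iff] at h0
    subst h0
    exact (SimpleGraph.induceUnivIso G).connected_iff.2 h.2.1
  · have : t = {v}ᶜ := by rw [← hv, compl_compl]
    subst this
    exact h.2.2 v

namespace Rooted

variable {d : ℕ} (N : Rooted d)

theorem exists_neighbor_mem {t : Set (Fin N.net.n)} (ht : (N.net.G.induce t).Connected)
    (hr : N.root ∈ t) {y : Fin N.net.n} (hy : y ∈ t) (hne : y ≠ N.root) :
    ∃ i, (N.neighbor i : Fin N.net.n) ∈ t := by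
  obtain ⟨p⟩ := ht.preconnected ⟨N.root, hr⟩ ⟨y, hy⟩
  cases p with
  | nil => exact (hne rfl).elim
  | @cons _ u _ hadj _ =>
    refine ⟨N.port.symm ⟨u, hadj⟩, ?_⟩
    change ((N.port (N.port.symm ⟨u, hadj⟩) : N.net.G.neighborSet N.root) : Fin N.net.n) ∈ t
    rw [Equiv.apply_symm_apply]
    exact u.2

/-- The distinguished agent has degree at least two: once a neighbour is removed, the remaining
connected graph still contains another vertex, so a second neighbour is needed. -/
theorem exists_ports (hN : TwoConnected N.net.G) : ∃ i j : Fin d, i ≠ j := by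
  have hcard : ∀ a b : Fin N.net.n, ∃ y, y ≠ a ∧ y ≠ b := by
    intro a b
    have h3 : 3 ≤ N.net.n := hN.1
    have : ({a, b} : Finset (Fin N.net.n)).card < (Finset.univ : Finset (Fin N.net.n)).card := by
      rw [Finset.card_univ, Fintype.card_fin]
      exact lt_of_le_of_lt Finset.card_le_two (by omega)
    obtain ⟨y, -, hy⟩ := Finset.exists_mem_notMem_of_card_lt_card this
    simp only [Finset.mem_insert, Finset.mem_singleton, not_or] at hy
    exact ⟨y, hy⟩
  obtain ⟨y, hy, -⟩ := hcard N.root N.root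
  obtain ⟨i, -⟩ := N.exists_neighbor_mem (hN.induce_connected (t := Set.univ) (by simp))
    (Set.mem_univ _) (Set.mem_univ y) hy
  obtain ⟨y, hy, hy'⟩ := hcard N.root (N.neighbor i)
  obtain ⟨j, hj⟩ := N.exists_neighbor_mem (hN.induce_connected (t := {(N.neighbor i).1}ᶜ) (by simp))
    (fun h => (N.neighbor i).2 h.symm) hy' hy
  exact ⟨i, j, fun h => hj (by rw [h]; rfl)⟩

/-- After the removal of at most one vertex, every remaining agent of a 2-connected network is
still connected to one of the vertices `g i` that replace the distinguished agent. -/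
theorem exists_reachable (hN : TwoConnected N.net.G) {W : Type} {H : SimpleGraph W}
    {f : N.Other → W} {g : Fin d → W} (hf : Function.Injective f) (hg : Function.Injective g)
    (hfg : ∀ v i, f v ≠ g i) (hff : ∀ v v' : N.Other, N.net.G.Adj v v' → H.Adj (f v) (f v'))
    (hfg' : ∀ i, H.Adj (f (N.neighbor i)) (g i)) {s : Set W} (hs : sᶜ.Subsingleton)
    (v : N.Other) (hv : f v ∈ s) :
    ∃ i, ∃ hi : g i ∈ s, (H.induce s).Reachable ⟨f v, hv⟩ ⟨g i, hi⟩ := by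
  by_cases hall : ∀ i, g i ∈ s
  -- The deleted vertex is not one of the `g i`. Pulled back to N, with the root kept, at most one
  -- vertex is deleted, and a walk to the root is followed until it first meets the root.
  · set t : Set (Fin N.net.n) := {x | ∀ h : x ≠ N.root, f ⟨x, h⟩ ∈ s} with ht
    have htc : tᶜ.Subsingleton := by
      intro x hx y hy
      simp only [ht, Set.mem_compl_iff, Set.mem_ofPred_eq, not_forall] at hx hy
      obtain ⟨hx, hx'⟩ := hx
      obtain ⟨hy, hy'⟩ := hy
      exact congrArg Subtype.val (hf (hs hx' hy'))
    have key : ∀ a b : t, (N.net.G.induce t).Walk a b → b.1 = N.root →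
        ∀ ha : a.1 ≠ N.root, ∃ i, ∃ hi : g i ∈ s,
          (H.induce s).Reachable ⟨f ⟨a, ha⟩, a.2 ha⟩ ⟨g i, hi⟩ := by
      intro a b p hb
      induction p with
      | nil => intro ha; exact (ha hb).elim
      | @cons a u _ hadj p ih =>
        intro ha
        have hadj' : N.net.G.Adj a u := hadj
        by_cases hu : u.1 = N.root
        · have h1 : N.net.G.Adj N.root a := by rw [← hu]; exact hadj'.symm
          refine ⟨N.port.symm ⟨a, h1⟩, hall _, SimpleGraph.Adj.reachable ?_⟩
          have h2 : N.neighbor (N.port.symm ⟨a, h1⟩) = ⟨a, ha⟩ := N.neighbor_port_symm ⟨a, ha⟩ h1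
          have h3 := hfg' (N.port.symm ⟨a, h1⟩)
          rw [h2] at h3
          exact h3
        · obtain ⟨i, hi, hr⟩ := ih hb hu
          refine ⟨i, hi, SimpleGraph.Reachable.trans (SimpleGraph.Adj.reachable ?_) hr⟩
          exact hff ⟨a, ha⟩ ⟨u, hu⟩ hadj'
    obtain ⟨p⟩ := (hN.induce_connected htc).preconnected ⟨v, fun _ => hv⟩
      ⟨N.root, fun h => (h rfl).elim⟩
    exact key _ _ p rfl v.2
  -- The deleted vertex is some `g i₀`, so all other agents survive. They stay connected without the
  -- root, and a second port j leads out.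
  · push Not at hall
    obtain ⟨i₀, hi₀⟩ := hall
    have hmem : ∀ w, w ≠ g i₀ → w ∈ s := fun w hw => by
      by_contra h
      exact hw (hs h hi₀)
    obtain ⟨j, hj⟩ : ∃ j, j ≠ i₀ := by
      obtain ⟨i, j, hij⟩ := N.exists_ports hN
      by_cases h : i = i₀
      · exact ⟨j, fun h' => hij (h.trans h'.symm)⟩
      · exact ⟨i, h⟩
    have hjs : g j ∈ s := hmem _ fun h => hj (hg h)
    refine ⟨j, hjs, ?_⟩
    let φ : N.net.G.induce {N.root}ᶜ →g H.induce s :=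
      { toFun := fun x => ⟨f ⟨x, x.2⟩, hmem _ (hfg _ _)⟩
        map_rel' := fun {a b} h => hff ⟨a, a.2⟩ ⟨b, b.2⟩ h }
    have h1 := ((hN.2.2 N.root).preconnected ⟨v, v.2⟩ ⟨N.neighbor j, (N.neighbor j).2⟩).map φ
    exact h1.trans (SimpleGraph.Adj.reachable (hfg' j))

end Rooted

section Join

variable {d : ℕ} {N₁ N₂ : Rooted d} {L : ℕ}

/-- The middle is complete and has at least two vertices, so after one deletion it is connected and
nonempty. Every surviving agent of a half reaches it. -/
theorem join_induce_connected (h₁ : TwoConnected N₁.net.G) (h₂ : TwoConnected N₂.net.G)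
    (s : Set (JoinVertex N₁ N₂ L)) (hs : sᶜ.Subsingleton) :
    ((join N₁ N₂ L).graph.induce s).Connected := by
  obtain ⟨i, j, hij⟩ := N₁.exists_ports h₁
  obtain ⟨r₀, hr₀⟩ : ∃ r : Mid d L, (Sum.inl r : JoinVertex N₁ N₂ L) ∈ s := by
    by_contra hcon
    push Not at hcon
    have := hs (hcon (Sum.inl i)) (hcon (Sum.inl j))
    simp only [Sum.inl.injEq] at this
    exact hij this
  have hmid : ∀ (r : Mid d L) (hr : (Sum.inl r : JoinVertex N₁ N₂ L) ∈ s),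
      ((join N₁ N₂ L).graph.induce s).Reachable ⟨Sum.inl r, hr⟩ ⟨Sum.inl r₀, hr₀⟩ := by
    intro r hr
    by_cases h : r₀ = r
    · subst h; exact SimpleGraph.Reachable.refl _
    · refine SimpleGraph.Adj.reachable ?_
      exact ⟨Sum.inl ⟨r₀, h⟩, rfl⟩
  have hall : ∀ w (hw : w ∈ s),
      ((join N₁ N₂ L).graph.induce s).Reachable ⟨w, hw⟩ ⟨Sum.inl r₀, hr₀⟩ := by
    rintro (r | v | v) hw
    · exact hmid r hw
    · obtain ⟨i, hi, hr⟩ := N₁.exists_reachable h₁ (H := (join N₁ N₂ L).graph)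
        (f := fun v => Sum.inr (Sum.inl v)) (g := fun i => Sum.inl (Sum.inl i))
        (Sum.inr_injective.comp Sum.inl_injective) (Sum.inl_injective.comp Sum.inl_injective)
        (fun _ _ h => Sum.inr_ne_inl h)
        (fun v v' h => ⟨⟨v', h⟩, joinDir_left N₁ N₂ L v ⟨v', h⟩ v'.2⟩)
        (fun i => ⟨⟨N₁.root, N₁.adj_neighbor i⟩, joinDir_left_neighbor N₁ N₂ L i⟩) hs v hw
      exact hr.trans (hmid _ hi)
    · obtain ⟨i, hi, hr⟩ := N₂.exists_reachable h₂ (H := (join N₁ N₂ L).graph)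
        (f := fun v => Sum.inr (Sum.inr v)) (g := fun i => Sum.inl (Sum.inl i))
        (Sum.inr_injective.comp Sum.inr_injective) (Sum.inl_injective.comp Sum.inl_injective)
        (fun _ _ h => Sum.inr_ne_inl h)
        (fun v v' h => ⟨⟨v', h⟩, joinDir_right N₁ N₂ L v ⟨v', h⟩ v'.2⟩)
        (fun i => ⟨⟨N₂.root, N₂.adj_neighbor i⟩, joinDir_right_neighbor N₁ N₂ L i⟩) hs v hw
      exact hr.trans (hmid _ hi)
  rw [SimpleGraph.connected_iff_exists_forall_reachable]
  exact ⟨⟨Sum.inl r₀, hr₀⟩, fun w => (hall w.1 w.2).symm⟩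

theorem card_joinVertex : Fintype.card (JoinVertex N₁ N₂ L) =
    (d + L) + ((N₁.net.n - 1) + (N₂.net.n - 1)) := by
  simp [JoinVertex, Mid, Rooted.Other, Fintype.card_subtype_compl]

end Join

/-! ### Counting inputs -/

/-- If `f` depends on one coordinate in a balanced way, then for uniform inputs all its values are
equally likely. -/
theorem ex_uniform_of_balanced {ι X Y : Type} [Fintype ι] [DecidableEq ι] [Fintype X] [Nonempty X]
    [Fintype Y] (f : (ι → X) → Y) (v : ι)
    (hf : ∀ x y y', Nat.card {z : X // f (Function.update x v z) = y} =
      Nat.card {z : X // f (Function.update x v z) = y'}) (p : Y) :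
    ex (PMF.uniformOfFintype (ι → X)) (fun x => ind (f x = p)) = (Fintype.card Y : ℝ≥0∞)⁻¹ := by
  classical
  have hcount : ∀ y, Fintype.card {x // f x = y} = Fintype.card {x // f x = p} := by
    intro y
    let e := (Equiv.funSplitAt v X).symm
    -- Each fibre is counted by first fixing all coordinates other than v; balance then makes the
    -- counts agree slice by slice.
    have h1 : ∀ y, Fintype.card {x // f x = y} =
        ∑ w : {j // j ≠ v} → X, Fintype.card {z : X // f (e (z, w)) = y} := by
      intro y
      rw [← Fintype.card_sigma]
      refine Fintype.card_congr ?_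
      refine ((e.subtypeEquiv (p := fun g => f (e g) = y) fun g => Iff.rfl).symm).trans ?_
      exact {
        toFun := fun g => ⟨g.1.2, ⟨g.1.1, g.2⟩⟩
        invFun := fun g => ⟨(g.2.1, g.1), g.2.2⟩
        left_inv := fun g => rfl
        right_inv := fun g => rfl }
    rw [h1, h1]
    refine Finset.sum_congr rfl fun w _ => ?_
    obtain ⟨z₀⟩ := ‹Nonempty X›
    have h2 : ∀ z, e (z, w) = Function.update (e (z₀, w)) v z := by
      intro z
      funext j
      by_cases hj : j = v
      · subst hj; simp [e, Equiv.funSplitAt]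
      · simp [e, Equiv.funSplitAt, hj]
    have := hf (e (z₀, w)) y p
    simp only [← h2, Nat.card_eq_fintype_card] at this
    exact this
  have htot : Fintype.card (ι → X) = Fintype.card Y * Fintype.card {x // f x = p} := by
    have h1 : Fintype.card (ι → X) = ∑ y, Fintype.card {x // f x = y} := by
      rw [← Fintype.card_sigma]
      exact Fintype.card_congr (Equiv.sigmaFiberEquiv f).symm
    rw [h1, Finset.sum_congr rfl fun y _ => hcount y, Finset.sum_const, Finset.card_univ,
      smul_eq_mul]
  have hsum : ex (PMF.uniformOfFintype (ι → X)) (fun x => ind (f x = p)) =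
      (Fintype.card (ι → X) : ℝ≥0∞)⁻¹ * Fintype.card {x // f x = p} := by
    unfold ex
    simp only [PMF.uniformOfFintype_apply]
    rw [ENNReal.tsum_mul_left, tsum_fintype]
    congr 1
    simp only [ind]
    rw [Finset.sum_ite, Finset.sum_const_zero, add_zero, Finset.sum_const, Fintype.card_subtype]
    simp
  have hpos : (Fintype.card {x // f x = p} : ℝ≥0∞) ≠ 0 := by
    intro h0
    have h0' : Fintype.card {x // f x = p} = 0 := by exact_mod_cast h0
    have : Fintype.card (ι → X) ≠ 0 := Fintype.card_ne_zero
    rw [htot, h0', mul_zero] at this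
    exact this rfl
  rw [hsum, htot]
  push_cast
  rw [ENNReal.mul_inv (Or.inr (by simp)) (Or.inr hpos), mul_assoc,
    ENNReal.inv_mul_cancel hpos (by simp), mul_one]

end

/-! ### Utility of honest agents and of deviators. -/

section

open Party

variable {X M Y : Type}

/-! ### Honest behaviour -/

theorem Strategy.out_of_step_ne_zero (Λ : Strategy X M Y) {s s' : Λ.State} {deg : ℕ}
    {r : Fin deg → M} (h : Λ.step s deg r s' ≠ 0) {o : Option Y} (ho : Λ.out s = some o) :
    Λ.out s' = some o :=
  Λ.out_step s deg r o ho s' ((PMF.mem_support_iff _ _).2 h)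

namespace Rooted

variable {d : ℕ} (N : Rooted d) (Λ : Strategy X M Y)

theorem others_out_of_step_ne_zero {x : Fin N.net.n → X} {s s' : N.Other → Λ.State}
    {m : Fin d → M} (h : (N.others Λ x).step s m s' ≠ 0) {o : Option Y}
    (ho : ∀ v, Λ.out (s v) = some o) (v : N.Other) : Λ.out (s' v) = some o := by
  have h1 : indep (fun v : N.Other => Λ.step (s v) (N.net.deg v) (N.incoming Λ s m v)) s' ≠ 0 := h
  exact Λ.out_of_step_ne_zero (indep_apply_ne_zero h1 v) (ho v)

theorem persistent_output (x : Fin N.net.n → X) (i : ℕ) (y : X) (p : Y) :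
    Persistent (N.others Λ x) (Λ.toParty i d y) fun g =>
      (∀ v, Λ.out (g.1 v) = some (some p)) ∧ Λ.out g.2 = some (some p) := by
  rintro g g' hg ⟨h1, h2⟩
  obtain ⟨h3, h4⟩ := round_ne_zero hg
  exact ⟨N.others_out_of_step_ne_zero Λ h3 h1, Λ.out_of_step_ne_zero h4 h2⟩

variable {Λ}

theorem iSup_correct {q : ∀ m : ℕ, (Fin m → X) → Y} {σ : PMF ℕ}
    (hΛ : SolvesKnowledgeSharing q σ Λ) (hN : TwoConnected N.net.G) (hσ : N.net.n ∈ σ.support)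
    (x : Fin N.net.n → X) :
    ⨆ t, ex (law (N.others Λ x) (Λ.toParty (N.net.ident N.root) d (x N.root)) t) (fun g =>
      ind ((∀ v, Λ.out (g.1 v) = some (some (q N.net.n x))) ∧
        Λ.out g.2 = some (some (q N.net.n x)))) = 1 := by
  have h := hΛ N.net hN hσ x
  rw [← h]
  refine iSup_congr fun t => ?_
  rw [toOuterMeasure_eq_ex, ← N.configLaw_split (prof := fun _ => Λ) rfl (fun _ => rfl) x t, ex_map]
  refine congrArg _ (funext fun c => ind_congr ?_)
  change ((∀ v : N.Other, Λ.out (c v) = some (some _)) ∧ Λ.out (c N.root) = some (some _)) ↔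
    ∀ v, (Λ.out (c v)).join = some _
  simp only [join_eq_some_iff]
  refine ⟨fun h v => ?_, fun h => ⟨fun v => h v, h _⟩⟩
  by_cases hv : v = N.root
  · rw [hv]; exact h.2
  · exact h.1 ⟨v, hv⟩

theorem iSup_output {q : ∀ m : ℕ, (Fin m → X) → Y} {σ : PMF ℕ}
    (hΛ : SolvesKnowledgeSharing q σ Λ) (hN : TwoConnected N.net.G) (hσ : N.net.n ∈ σ.support)
    (x : Fin N.net.n → X) (p : Y) :
    ⨆ t, ex (law (N.others Λ x) (Λ.toParty (N.net.ident N.root) d (x N.root)) t) (fun g =>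
      ind ((∀ v, Λ.out (g.1 v) = some (some p)) ∧ Λ.out g.2 = some (some p))) =
        ind (q N.net.n x = p) := by
  have h1 := N.iSup_correct hΛ hN hσ x
  by_cases hp : q N.net.n x = p
  · rw [ind_of hp, ← h1, hp]
  rw [ind_of_not hp, ENNReal.iSup_eq_zero]
  intro t
  rw [← ex_const (law (N.others Λ x) (Λ.toParty (N.net.ident N.root) d (x N.root)) t) 0]
  refine ex_congr_support fun g hg => ind_of_not fun hgp => ?_
  -- Had all agents output `p` at some reachable point, the correct value would still be reached
  -- almost surely from there, although outputs cannot be revised.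
  have h2 := iSup_run_eq_one (N.persistent_output Λ x _ _ _) h1 hg
  have h3 : ∀ r, ex (run (N.others Λ x) (Λ.toParty (N.net.ident N.root) d (x N.root)) g r)
      (fun g => ind ((∀ v, Λ.out (g.1 v) = some (some (q N.net.n x))) ∧
        Λ.out g.2 = some (some (q N.net.n x)))) = 0 := by
    intro r
    rw [← ex_const (run (N.others Λ x) (Λ.toParty (N.net.ident N.root) d (x N.root)) g r) 0]
    refine ex_congr_support fun g' hg' => ind_of_not fun hq => ?_
    have := (run_persistent (N.persistent_output Λ x _ _ p) hgp hg').2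
    rw [hq.2] at this
    simp only [Option.some.injEq] at this
    exact hp this
  exact zero_ne_one ((ENNReal.iSup_eq_zero.2 h3).symm.trans h2)

variable [Fintype X] [Nonempty X] [Fintype Y]

/-- All values are equally likely in honest executions. -/
theorem networkUtility_honest {q : ∀ m : ℕ, (Fin m → X) → Y} (hq : FullKnowledge q) {σ : PMF ℕ}
    (hΛ : SolvesKnowledgeSharing q σ Λ) (hN : TwoConnected N.net.G) (hσ : N.net.n ∈ σ.support)
    (p : Y) (i : X) :
    networkUtility Λ Λ p i ⟨N.net, N.root⟩ = (Fintype.card Y : ℝ≥0∞)⁻¹ := by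
  -- The agent's own input is fixed to i, so the balance must come from the uniform input of another
  -- agent.
  obtain ⟨v, hv⟩ : ∃ v : Fin N.net.n, v ≠ N.root := by
    obtain ⟨j, -⟩ := N.exists_ports hN
    exact ⟨_, (N.neighbor j).2⟩
  rw [← ex_uniform_of_balanced (fun x => q N.net.n (Function.update x N.root i)) v ?_ p]
  · refine tsum_congr fun x => ?_
    congr 1
    change _ = ind (q N.net.n (Function.update x N.root i) = p)
    rw [N.runUtility_eq, ← N.iSup_output hΛ hN hσ]
    rw [Function.update_self, N.others_congr (x' := x) fun v => Function.update_of_ne v.2 _ _]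
  · intro x y y'
    simp only [Function.update_comm hv]
    exact hq _ _ _ _ _

end Rooted

/-! ### Deviations -/

section Deviation

variable {d : ℕ} {Z : Type} (Λ : Strategy X M Y) (P : Party Z (Fin d → M) (Fin d → M))
  (o : Z → Option (Option Y))
  (ho : ∀ z m z', P.step z m z' ≠ 0 → ∀ y, o z = some y → o z' = some y) (m₀ : M)

/-- The strategy that behaves as the party `P` if the degree is `d`, and as `Λ` otherwise. -/
def deviation : Strategy X M Y where
  State := Λ.State ⊕ Z
  init i deg x := if deg = d then P.init.map Sum.inr else (Λ.init i deg x).map Sum.inl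
  msg s k := match s with
    | Sum.inl s => Λ.msg s k
    -- The message `m₀` on absent ports is a filler. Likewise, in `step`, simulated states with a
    -- wrong degree are frozen; that case never arises in an execution.
    | Sum.inr z => if h : k < d then P.out z ⟨k, h⟩ else m₀
  step s deg r := match s with
    | Sum.inl s => (Λ.step s deg r).map Sum.inl
    | Sum.inr z => if h : deg = d then (P.step z fun i => r (Fin.cast h.symm i)).map Sum.inr
      else PMF.pure (Sum.inr z)
  out s := match s with
    | Sum.inl s => Λ.out s
    | Sum.inr z => o z
  out_step := by
    rintro (s | z) deg r y hy s' hs'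
    · obtain ⟨s'', h, rfl⟩ := (PMF.mem_support_map_iff _ _ _).1 hs'
      exact Λ.out_step s deg r y hy s'' h
    · simp only at hs' hy
      split_ifs at hs' with h
      · obtain ⟨s'', h, rfl⟩ := (PMF.mem_support_map_iff _ _ _).1 hs'
        exact ho _ _ _ ((PMF.mem_support_iff _ _).1 h) _ hy
      · rw [PMF.mem_support_pure_iff] at hs'
        subst hs'
        exact hy

/-- With degree `d` the deviation is the party `P`. -/
def deviationHom (i : ℕ) (x : X) : Hom P ((deviation Λ P o ho m₀).toParty i d x) where
  map := Sum.inr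
  init := by simp [Strategy.toParty, deviation]
  out z := by funext k; simp [Strategy.toParty, deviation]
  step z m := by simp [Strategy.toParty, deviation]

/-- With another degree the deviation is `Λ`. -/
def honestHom {d' : ℕ} (h : d' ≠ d) (i : ℕ) (x : X) :
    Hom (Λ.toParty i d' x) ((deviation Λ P o ho m₀).toParty i d' x) where
  map := Sum.inl
  init := by simp [Strategy.toParty, deviation, h]
  out z := rfl
  step z m := rfl

variable [Fintype X] [Nonempty X]

/-- The party `P` ignores the deviator's own input, so the value does not depend on `i`; one gain
serves all inputs. -/
theorem networkUtility_deviation (N : Rooted d) (p : Y) (i : X) :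
    networkUtility Λ (deviation Λ P o ho m₀) p i ⟨N.net, N.root⟩ =
      ex (PMF.uniformOfFintype (Fin N.net.n → X)) fun x => ⨆ t, ex (law (N.others Λ x) P t) fun g =>
        ind ((∀ v, Λ.out (g.1 v) = some (some p)) ∧ o g.2 = some (some p)) := by
  refine tsum_congr fun x => ?_
  congr 1
  rw [N.runUtility_eq]
  refine iSup_congr fun t => ?_
  rw [← law_map (Hom.id _) (deviationHom Λ P o ho m₀ _ i), ex_map]
  rfl

theorem networkUtility_deviation_of_ne {d' : ℕ} (h : d' ≠ d) (N : Rooted d') (p : Y) (i : X) :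
    networkUtility Λ (deviation Λ P o ho m₀) p i ⟨N.net, N.root⟩ =
      networkUtility Λ Λ p i ⟨N.net, N.root⟩ := by
  refine tsum_congr fun x => ?_
  congr 1
  rw [N.runUtility_eq, N.runUtility_eq]
  refine iSup_congr fun t => ?_
  rw [← law_map (Hom.id _) (honestHom Λ P o ho m₀ h _ i), ex_map]
  rfl

end Deviation

end

/-! ### Identifiers and the two random halves. -/

section

open Party

variable {X M Y : Type}

/-! ### Adding identifiers -/

/-- The identifier of an agent in one of two disjoint families of identifiers. -/
def familyIdent (b : Bool) (v : ℕ) : ℕ := 3 * v + bif b then 1 else 2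

/-- Add identifiers to a topology: the distinguished agent gets the identifier `0` and the others
get identifiers of the family `b`. -/
abbrev withIdent (b : Bool) (T : PointedTopology) : PointedNetwork :=
  ⟨{ T.1 with
      ident := fun v => if v = T.2 then 0 else familyIdent b v
      ident_injective := by
        intro v w h
        refine Fin.ext ?_
        simp only [familyIdent] at h
        cases b <;> split_ifs at h with h1 h2 h2 <;> simp only [cond_true, cond_false] at h
        all_goals first
          | (rw [h1, h2])
          | omega }, T.2⟩

/-- The topologies in which the distinguished agent has degree `d`. -/
abbrev RootedTopology (d : ℕ) : Type := {T : PointedTopology | T.1.deg T.2 = d}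

/-- A rooted topology with identifiers of the family `b`. -/
abbrev rooted {d : ℕ} (b : Bool) (T : RootedTopology d) : Rooted d where
  net := (withIdent b T.1).1
  root := T.1.2
  deg_root := T.2

theorem ident_mod_three {d : ℕ} (b : Bool) (T : RootedTopology d) (v : (rooted b T).Other) :
    (rooted b T).net.ident v % 3 = bif b then 1 else 2 := by
  change (if v.1 = T.1.2 then 0 else familyIdent b v) % 3 = _
  rw [if_neg v.2]
  cases b <;> simp [familyIdent, Nat.add_mod]

theorem middle_out_of_step_ne_zero {Λ : Strategy X M Y} {d : ℕ} (x₀ : X) (L : ℕ)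
    {s s' : Mid d L → Λ.State} {m : (Fin d → M) × (Fin d → M)}
    (h : (middle Λ d L x₀).step s m s' ≠ 0) {o : Option Y} {r : Mid d L}
    (ho : Λ.out (s r) = some o) : Λ.out (s' r) = some o := by
  have h1 : indep (fun r => Λ.step (s r) (midDeg r) (midIncoming Λ s m r)) s' ≠ 0 := h
  exact Λ.out_of_step_ne_zero (indep_apply_ne_zero h1 r) ho

/-! ### Two random halves of a network -/

section Halves

variable {d : ℕ}

/-- A topology with inputs. -/
abbrev Half (X : Type) (d : ℕ) : Type := Σ T : RootedTopology d, Fin T.1.1.n → X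

section Joined

variable (Λ : Strategy X M Y)
variable (q : ∀ m : ℕ, (Fin m → X) → Y) (x₀ : X) (L : ℕ)

/-- The value of `q` in the joined network. -/
def joinValue (h₁ h₂ : Half X d) : Y :=
  q (Fintype.card (JoinVertex (rooted true h₁.1) (rooted false h₂.1) L)) fun u =>
    joinInput (rooted true h₁.1) (rooted false h₂.1) L x₀ h₁.2 h₂.2 ((Fintype.equivFin _).symm u)

/-- All agents of the joined network have output `y`. -/
def AllOutput {h₁ h₂ : Half X d} (y : Y) (g : ((rooted true h₁.1).Other → Λ.State) ×
    ((Mid d L → Λ.State) × ((rooted false h₂.1).Other → Λ.State))) : Prop :=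
  (∀ v, Λ.out (g.1 v) = some (some y)) ∧ (∀ r, Λ.out (g.2.1 r) = some (some y)) ∧
    ∀ v, Λ.out (g.2.2 v) = some (some y)

variable {Λ q}

theorem persistent_allOutput (h₁ h₂ : Half X d) (y : Y) :
    Persistent ((rooted true h₁.1).others Λ h₁.2)
      (attach (middle Λ d L x₀) ((rooted false h₂.1).others Λ h₂.2))
      (AllOutput Λ L (h₁ := h₁) (h₂ := h₂) y) := by
  rintro g g' hg ⟨h1, h2, h3⟩
  obtain ⟨h4, h5⟩ := round_ne_zero hg
  obtain ⟨h6, h7⟩ := attach_step_ne_zero h5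
  exact ⟨Rooted.others_out_of_step_ne_zero _ Λ h4 h1,
    fun r => middle_out_of_step_ne_zero x₀ L h6 (h2 r),
    Rooted.others_out_of_step_ne_zero _ Λ h7 h3⟩

/-- The extra `L` vertices serve here to push the size beyond n₀, where `σ` is positive and
correctness of `Λ` applies. -/
theorem iSup_allOutput {σ : PMF ℕ} (hΛ : SolvesKnowledgeSharing q σ Λ) {n₀ : ℕ}
    (hσ : ∀ m > n₀, 0 < σ m) (hL : n₀ < L) (h₁ h₂ : Half X d)
    (hT₁ : TwoConnected h₁.1.1.1.G) (hT₂ : TwoConnected h₂.1.1.1.G) :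
    ⨆ t, ex (law ((rooted true h₁.1).others Λ h₁.2)
      (attach (middle Λ d L x₀) ((rooted false h₂.1).others Λ h₂.2)) t)
      (fun g => ind (AllOutput Λ L (joinValue q x₀ L h₁ h₂) g)) = 1 := by
  set N₁ := rooted true h₁.1
  set N₂ := rooted false h₂.1
  have hid := joinIdent_injective N₁ N₂ L (ident_mod_three true h₁.1) (ident_mod_three false h₂.1)
  have hcard := card_joinVertex (N₁ := N₁) (N₂ := N₂) (L := L)
  have h3 : 3 ≤ N₁.net.n := hT₁.1
  have h3' : 3 ≤ N₂.net.n := hT₂.1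
  have h2c : TwoConnected ((join N₁ N₂ L).net (joinIdent N₁ N₂ L) hid).G :=
    (join N₁ N₂ L).twoConnected_net _ hid (by omega) (join_induce_connected hT₁ hT₂)
  have hn : Fintype.card (JoinVertex N₁ N₂ L) ∈ σ.support :=
    (PMF.mem_support_iff _ _).2 (hσ _ (by omega)).ne'
  have h := hΛ _ h2c hn fun u =>
    joinInput N₁ N₂ L x₀ h₁.2 h₂.2 ((Fintype.equivFin _).symm u)
  rw [← h]
  refine iSup_congr fun t => ?_
  rw [toOuterMeasure_eq_ex, ← vertexLaw_join, ← (join N₁ N₂ L).configLaw_net Λ _ hid, ex_map,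
    ex_map]
  refine congrArg _ (funext fun c => ind_congr ?_)
  change ((∀ v, Λ.out (c (Fintype.equivFin (JoinVertex N₁ N₂ L) (Sum.inr (Sum.inl v)))) =
      some (some _)) ∧
    (∀ r, Λ.out (c (Fintype.equivFin (JoinVertex N₁ N₂ L) (Sum.inl r))) = some (some _)) ∧
    ∀ v, Λ.out (c (Fintype.equivFin (JoinVertex N₁ N₂ L) (Sum.inr (Sum.inr v)))) = some (some _)) ↔
    ∀ u, (Λ.out (c u)).join = some _
  simp only [Rooted.join_eq_some_iff]
  refine ⟨fun ⟨h1, h2, h3⟩ u => ?_, fun h => ⟨fun v => h _, fun r => h _, fun v => h _⟩⟩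
  obtain ⟨w, rfl⟩ := (Fintype.equivFin (JoinVertex N₁ N₂ L)).surjective u
  rcases w with r | v | v
  · exact h2 r
  · exact h1 v
  · exact h3 v

end Joined

variable [Fintype X] [Nonempty X]

/-- A random topology with uniform inputs. -/
def halfLaw (π : PMF (RootedTopology d)) : PMF (Half X d) :=
  π.bind fun T => (PMF.uniformOfFintype (Fin T.1.1.n → X)).map (Sigma.mk T)

theorem ex_halfLaw (π : PMF (RootedTopology d)) (F : Half X d → ℝ≥0∞) :
    ex (halfLaw π) F =
      ex π fun T => ex (PMF.uniformOfFintype (Fin T.1.1.n → X)) fun x => F ⟨T, x⟩ := by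
  unfold halfLaw
  rw [ex_bind]
  simp only [ex_map]

theorem mem_support_of_halfLaw_ne_zero {π : PMF (RootedTopology d)} {h : Half X d}
    (hh : halfLaw π h ≠ 0) : π h.1 ≠ 0 := by
  obtain ⟨T, hT, h1⟩ := (PMF.mem_support_bind_iff _ _ _).1 ((PMF.mem_support_iff _ _).2 hh)
  obtain ⟨x, -, rfl⟩ := (PMF.mem_support_map_iff _ _ _).1 h1
  exact (PMF.mem_support_iff _ _).1 hT

variable (Λ : Strategy X M Y)

/-- A random half, executing `Λ`. -/
def half (b : Bool) (π : PMF (RootedTopology d)) :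
    Party (Σ h : Half X d, (rooted b h.1).Other → Λ.State) (Fin d → M) (Fin d → M) :=
  mix (halfLaw π) fun h => (rooted b h.1).others Λ h.2

theorem half_step_ne_zero {b : Bool} {π : PMF (RootedTopology d)}
    {s s' : Σ h : Half X d, (rooted b h.1).Other → Λ.State} {m : Fin d → M}
    (h : (half Λ b π).step s m s' ≠ 0) :
    ∃ z, s' = ⟨s.1, z⟩ ∧ ((rooted b s.1.1).others Λ s.1.2).step s.2 m z ≠ 0 := by
  obtain ⟨z, hz, rfl⟩ := (PMF.mem_support_map_iff _ _ _).1 ((PMF.mem_support_iff _ _).2 h)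
  exact ⟨z, rfl, (PMF.mem_support_iff _ _).1 hz⟩

theorem ex_half_init (b : Bool) (π : PMF (RootedTopology d)) (F : Half X d → ℝ≥0∞) :
    ex (half Λ b π).init (fun s => F s.1) = ex (halfLaw π) F := by
  unfold half mix
  simp only
  rw [ex_bind]
  refine congrArg _ (funext fun h => ?_)
  rw [ex_map]
  exact ex_const _ (F h)

variable {Λ} {q : ∀ m : ℕ, (Fin m → X) → Y} (x₀ : X) (L : ℕ)

theorem ex_law_halves (π : PMF (RootedTopology d)) (t : ℕ)
    (F : (Σ h : Half X d, (rooted true h.1).Other → Λ.State) ×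
      ((Mid d L → Λ.State) × (Σ h : Half X d, (rooted false h.1).Other → Λ.State)) → ℝ≥0∞) :
    ex (law (half Λ true π) (attach (middle Λ d L x₀) (half Λ false π)) t) F =
      ex (halfLaw π) fun h₁ => ex (halfLaw π) fun h₂ =>
        ex (law ((rooted true h₁.1).others Λ h₁.2)
          (attach (middle Λ d L x₀) ((rooted false h₂.1).others Λ h₂.2)) t) fun g =>
          F (⟨h₁, g.1⟩, (g.2.1, ⟨h₂, g.2.2⟩)) := by
  unfold half
  rw [ex_law_mix]
  refine congrArg _ (funext fun h₁ => ?_)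
  refine (ex_law_permute (middle Λ d L x₀).swap _ _ t _).trans ?_
  rw [ex_law_mix]
  refine congrArg _ (funext fun h₂ => ?_)
  rw [ex_law_permute]

theorem iSup_allOutput_halves {σ : PMF ℕ} (hΛ : SolvesKnowledgeSharing q σ Λ)
    {n₀ : ℕ} (hσ : ∀ m > n₀, 0 < σ m) {π : PMF (RootedTopology d)}
    (hπ : ∀ T, π T ≠ 0 → TwoConnected T.1.1.G) :
    ⨆ t, ex (law (half Λ true π) (attach (middle Λ d (n₀ + 1) x₀) (half Λ false π)) t) (fun g =>
      ind (AllOutput Λ (n₀ + 1) (h₁ := g.1.1) (h₂ := g.2.2.1)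
        (joinValue q x₀ (n₀ + 1) g.1.1 g.2.2.1) (g.1.2, (g.2.1, g.2.2.2)))) = 1 := by
  obtain ⟨J, hJ⟩ : ∃ J : ℕ → Half X d → Half X d → ℝ≥0∞, J = fun t h₁ h₂ =>
      ex (law ((rooted true h₁.1).others Λ h₁.2)
        (attach (middle Λ d (n₀ + 1) x₀) ((rooted false h₂.1).others Λ h₂.2)) t) fun g =>
        ind (AllOutput Λ (n₀ + 1) (h₁ := h₁) (h₂ := h₂) (joinValue q x₀ (n₀ + 1) h₁ h₂) g) :=
    ⟨_, rfl⟩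
  have hmono : ∀ h₁ h₂, Monotone fun t => J t h₁ h₂ := fun h₁ h₂ => by
    rw [hJ]; exact law_mono (persistent_allOutput x₀ (n₀ + 1) h₁ h₂ _)
  have hone : ∀ h₁ h₂, halfLaw π h₁ ≠ 0 → halfLaw π h₂ ≠ 0 → ⨆ t, J t h₁ h₂ = 1 := by
    intro h₁ h₂ hh₁ hh₂
    rw [hJ]
    exact iSup_allOutput x₀ _ hΛ hσ (Nat.lt_succ_self _) h₁ h₂
      (hπ _ (mem_support_of_halfLaw_ne_zero hh₁)) (hπ _ (mem_support_of_halfLaw_ne_zero hh₂))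
  have hex : ∀ t, ex (law (half Λ true π) (attach (middle Λ d (n₀ + 1) x₀) (half Λ false π)) t)
      (fun g => ind (AllOutput Λ (n₀ + 1) (h₁ := g.1.1) (h₂ := g.2.2.1)
        (joinValue q x₀ (n₀ + 1) g.1.1 g.2.2.1) (g.1.2, (g.2.1, g.2.2.2)))) =
      ex (halfLaw π) fun h₁ => ex (halfLaw π) fun h₂ => J t h₁ h₂ := fun t => by
    rw [hJ]; exact ex_law_halves x₀ (n₀ + 1) π t _
  -- Monotone convergence is applied once for each half: almost sure correctness for each fixed pair
  -- passes to the mixture without a uniform time bound.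
  rw [iSup_congr hex, ← ex_iSup fun h₁ t t' htt => ex_mono fun h₂ => hmono h₁ h₂ htt,
    ← ex_const (halfLaw (X := X) π) 1]
  refine ex_congr_support fun h₁ hh₁ => ?_
  rw [← ex_iSup fun h₂ => hmono h₁ h₂, ← ex_const (halfLaw (X := X) π) 1]
  exact ex_congr_support fun h₂ hh₂ => hone h₁ h₂ hh₁ hh₂

variable [Fintype Y]

/-- With the first half and the second topology fixed, the uniform input of one agent of the second
half already makes all values equally likely. -/
theorem ex_joinValue (hq : FullKnowledge q) (p : Y) {π : PMF (RootedTopology d)}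
    (hπ : ∀ T, π T ≠ 0 → TwoConnected T.1.1.G) :
    ex (halfLaw π) (fun h₁ => ex (halfLaw π) fun h₂ =>
      ind (joinValue q x₀ L h₁ h₂ = p)) = (Fintype.card Y : ℝ≥0∞)⁻¹ := by
  rw [← ex_const (halfLaw (X := X) π) (Fintype.card Y : ℝ≥0∞)⁻¹]
  refine congrArg _ (funext fun h₁ => ?_)
  rw [ex_halfLaw, ← ex_const π (Fintype.card Y : ℝ≥0∞)⁻¹]
  refine ex_congr_support fun T hT => ?_
  obtain ⟨j, -⟩ := (rooted false T).exists_ports (hπ T hT)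
  set v := (rooted false T).neighbor j
  refine ex_uniform_of_balanced (fun x => joinValue q x₀ L h₁ ⟨T, x⟩) v.1 (fun x y y' => ?_) p
  have key : ∀ z, joinValue q x₀ L h₁ ⟨T, Function.update x v.1 z⟩ =
      q _ (Function.update (fun u => joinInput (rooted true h₁.1) (rooted false T) L x₀ h₁.2 x
        ((Fintype.equivFin _).symm u)) (Fintype.equivFin _ (Sum.inr (Sum.inr v))) z) := by
    intro z
    unfold joinValue
    congr 1
    funext u
    obtain ⟨w, rfl⟩ :=
      (Fintype.equivFin (JoinVertex (rooted true h₁.1) (rooted false T) L)).surjective u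
    rw [Equiv.symm_apply_apply]
    by_cases hw : w = Sum.inr (Sum.inr v)
    · subst hw
      rw [Function.update_self]
      exact Function.update_self _ _ _
    · rw [Function.update_of_ne fun h => hw ((Fintype.equivFin _).injective h),
        Equiv.symm_apply_apply]
      rcases w with r | w | w
      · rfl
      · rfl
      · refine Function.update_of_ne (fun h => hw ?_) _ _
        rw [Subtype.ext h]
  simp only [key]
  exact hq _ _ _ _ _

/-- Two random halves of a network that are connected through a complete graph. -/
theorem setting_halves (hq : FullKnowledge q) {σ : PMF ℕ} (hΛ : SolvesKnowledgeSharing q σ Λ)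
    {n₀ : ℕ} (hσ : ∀ m > n₀, 0 < σ m) (p : Y) {π : PMF (RootedTopology d)}
    (hπ : ∀ T, π T ≠ 0 → TwoConnected T.1.1.G) :
    Setting (half Λ true π) (half Λ false π) (middle Λ d (n₀ + 1) x₀)
      (fun s₁ s₂ => joinValue q x₀ (n₀ + 1) s₁.1 s₂.1 = p)
      (fun s₁ r s₂ => AllOutput Λ (n₀ + 1) (h₁ := s₁.1) (h₂ := s₂.1)
        (joinValue q x₀ (n₀ + 1) s₁.1 s₂.1) (s₁.2, (r, s₂.2)))
      (fun s => ∀ v, Λ.out (s.2 v) = some (some p))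
      (fun r => Λ.out (r (Sum.inr 0)) = some (some p))
      (fun s => ∀ v, Λ.out (s.2 v) = some (some p)) (Fintype.card Y : ℝ≥0∞)⁻¹ where
  good₁ s i s' h z := by
    obtain ⟨_, rfl, -⟩ := half_step_ne_zero Λ h
    rfl
  good₂ s i s' h z := by
    obtain ⟨_, rfl, -⟩ := half_step_ne_zero Λ h
    rfl
  persist₁ s i s' h h' := by
    obtain ⟨_, rfl, h2⟩ := half_step_ne_zero Λ h
    exact Rooted.others_out_of_step_ne_zero _ Λ h2 h'
  persist₂ s i s' h h' := by
    obtain ⟨_, rfl, h2⟩ := half_step_ne_zero Λ h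
    exact Rooted.others_out_of_step_ne_zero _ Λ h2 h'
  persistQ s i s' h h' := middle_out_of_step_ne_zero x₀ _ h h'
  persist s₁ i₁ s₁' r i r' s₂ i₂ s₂' h1 h2 h3 hc := by
    obtain ⟨z₁, rfl, h4⟩ := half_step_ne_zero Λ h1
    obtain ⟨z₂, rfl, h5⟩ := half_step_ne_zero Λ h3
    exact ⟨Rooted.others_out_of_step_ne_zero _ Λ h4 hc.1,
      fun r => middle_out_of_step_ne_zero x₀ _ h2 (hc.2.1 r),
      Rooted.others_out_of_step_ne_zero _ Λ h5 hc.2.2⟩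
  output s₁ r s₂ hc hg := by
    rw [hg] at hc
    exact ⟨hc.1, hc.2.1 _, hc.2.2⟩
  -- One vertex of the middle suffices as witness; `Sum.inr 0` exists because the middle has n₀ + 1
  -- extra vertices.
  sound s₁ r s₂ hc hr := by
    have := hc.2.1 (Sum.inr 0)
    simp only at this
    rw [hr] at this
    simp only [Option.some.injEq] at this
    exact this.symm
  prob := by
    rw [← ex_joinValue x₀ (n₀ + 1) hq p hπ, law, ex_pmfProd]
    rw [← ex_half_init Λ true π]
    refine congrArg _ (funext fun s₁ => ?_)
    simp only [attach]
    rw [ex_pmfProd, ← ex_half_init Λ false π]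
    exact ex_const _ (ex (half Λ false π).init fun s =>
      ind (joinValue q x₀ (n₀ + 1) s₁.1 s.1 = p))
  correct := iSup_allOutput_halves x₀ hΛ hσ hπ

end Halves

end

/-! ### Assembling the prior and the deviation. -/

section

open Party

variable {X M Y : Type}

/-! ### The prior and the deviation -/

open Classical in
/-- The output of a party that switches when the transcript is `c`. -/
def switchOutput {Z O I : Type} (c : List (O × I)) (o : Z → Option (Option Y))
    (z : Z × List (O × I)) : Option (Option Y) :=
  if c.length ≤ z.2.length then o z.1 else none

theorem switchOutput_eq_some_iff {Z O I : Type} (c : List (O × I)) (o : Z → Option (Option Y))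
    (z : Z × List (O × I)) (y : Option Y) :
    switchOutput c o z = some y ↔ c.length ≤ z.2.length ∧ o z.1 = some y := by
  unfold switchOutput
  split_ifs with h <;> simp [h]

/-- The jump may replace a simulated state that has already output by one that has not. Silence
until the transcript reaches the length of `c` keeps outputs irrevocable, since no jump happens
afterwards. -/
theorem switchOutput_of_step_ne_zero {Z O I : Type} {B : Party Z O I} {c : List (O × I)} {z₀ : Z}
    {o : Z → Option (Option Y)}
    (ho : ∀ z m z', B.step z m z' ≠ 0 → ∀ y, o z = some y → o z' = some y)
    (z : Z × List (O × I)) (m : O) (z' : Z × List (O × I)) (h : (B.switch c z₀).step z m z' ≠ 0)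
    (y : Option Y) (hy : switchOutput c o z = some y) : switchOutput c o z' = some y := by
  rw [switchOutput_eq_some_iff] at hy ⊢
  obtain ⟨w, hw, rfl⟩ := (PMF.mem_support_map_iff _ _ _).1 ((PMF.mem_support_iff _ _).2 h)
  have hne : (m, B.out z.1) :: z.2 ≠ c := by
    rintro rfl
    simp at hy
  rw [redirect_of_ne c z₀ hne]
  exact ⟨hy.1.trans (by simp), ho _ _ _ ((PMF.mem_support_iff _ _).1 hw) _ hy.2⟩

theorem Strategy.nonempty_message (Λ : Strategy X M Y) (x : X) : Nonempty M := by
  obtain ⟨s, -⟩ := (Λ.init 0 0 x).support_nonempty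
  exact ⟨Λ.msg s 0⟩

section Prior

variable [Fintype X] [Nonempty X] [Fintype Y] {d : ℕ}

/-- A party that gains against a random half is a deviation that gains under a suitable prior. -/
theorem exists_prior_of_gain {q : ∀ m : ℕ, (Fin m → X) → Y} (hq : FullKnowledge q) {σ : PMF ℕ}
    {Λ : Strategy X M Y} (hΛ : SolvesKnowledgeSharing q σ Λ) {τ : PMF PointedTopology}
    (hτ : ∀ T ∈ τ.support, TwoConnected T.1.G) (hτσ : ∀ T ∈ τ.support, T.1.n ∈ σ.support) {p : Y}
    (h0 : ∑' T : RootedTopology d, τ T.1 ≠ 0) (htop : ∑' T : RootedTopology d, τ T.1 ≠ ∞)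
    (b : Bool) {Z : Type} (P : Party Z (Fin d → M) (Fin d → M)) (o : Z → Option (Option Y))
    (ho : ∀ z m z', P.step z m z' ≠ 0 → ∀ y, o z = some y → o z' = some y) (t : ℕ)
    (hgain : (Fintype.card Y : ℝ≥0∞)⁻¹ <
      ex (law (half Λ b (PMF.normalize (fun T : RootedTopology d => τ T.1) h0 htop)) P t) fun g =>
        ind ((∀ v, Λ.out (g.1.2 v) = some (some p)) ∧ o g.2 = some (some p))) :
    ∃ (B : PMF PointedNetwork) (ident₀ : ℕ),
      B.map PointedNetwork.topology = τ ∧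
      (∀ N ∈ B.support, N.1.ident N.2 = ident₀) ∧
      ∃ D : Strategy X M Y,
        (∀ i : X, expectedUtility Λ Λ p i B < expectedUtility Λ D p i B) ∧
        ∃ N ∈ B.support, ∀ i : X, networkUtility Λ Λ p i N < networkUtility Λ D p i N := by
  set π := PMF.normalize (fun T : RootedTopology d => τ T.1) h0 htop with hπ
  set θ : ℝ≥0∞ := (Fintype.card Y : ℝ≥0∞)⁻¹ with hθ
  obtain ⟨m₀⟩ := Λ.nonempty_message (Classical.arbitrary X)
  set D := deviation Λ P o ho m₀ with hD
  have hhonest : ∀ T ∈ τ.support, ∀ i, networkUtility Λ Λ p i (withIdent b T) = θ := by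
    intro T hT i
    exact (rooted b (⟨T, rfl⟩ : RootedTopology (T.1.deg T.2))).networkUtility_honest hq hΛ
      (hτ T hT) (hτσ T hT) p i
  have hother : ∀ T ∈ τ.support, T.1.deg T.2 ≠ d → ∀ i,
      networkUtility Λ D p i (withIdent b T) = θ := by
    intro T hT hd i
    rw [← hhonest T hT i]
    exact networkUtility_deviation_of_ne Λ P o ho m₀ hd
      (rooted b (⟨T, rfl⟩ : RootedTopology (T.1.deg T.2))) p i
  obtain ⟨u, hu⟩ : ∃ u : RootedTopology d → ℝ≥0∞, u = fun T =>
      ex (PMF.uniformOfFintype (Fin T.1.1.n → X)) fun x =>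
        ⨆ t, ex (law ((rooted b T).others Λ x) P t) fun g =>
          ind ((∀ v, Λ.out (g.1 v) = some (some p)) ∧ o g.2 = some (some p)) := ⟨_, rfl⟩
  have hdev : ∀ (T : RootedTopology d) i, networkUtility Λ D p i (withIdent b T.1) = u T := by
    intro T i
    rw [hu]
    exact networkUtility_deviation Λ P o ho m₀ (rooted b T) p i
  have hgain' : θ < ex π u := by
    refine hgain.trans_le ?_
    unfold half
    rw [ex_law_mix, ex_halfLaw, hu]
    exact ex_mono fun T => ex_mono fun x => le_iSup (fun t =>
      ex (law ((rooted b T).others Λ x) P t) fun g =>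
        ind ((∀ v, Λ.out (g.1 v) = some (some p)) ∧ o g.2 = some (some p))) t
  have hθtop : θ ≠ ∞ := (hgain'.trans_le le_top).ne
  have hexp : ∀ (S : Strategy X M Y) i, expectedUtility Λ S p i (τ.map (withIdent b)) =
      ex τ fun T => networkUtility Λ S p i (withIdent b T) := fun S i =>
    ex_map τ (withIdent b) fun N => networkUtility Λ S p i N
  refine ⟨τ.map (withIdent b), 0, ?_, ?_, D, fun i => ?_, ?_⟩
  · rw [PMF.map_comp]
    exact PMF.map_id τ
  · intro N hN
    obtain ⟨T, -, rfl⟩ := (PMF.mem_support_map_iff _ _ _).1 hN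
    exact if_pos rfl
  · rw [hexp, hexp]
    have h1 : ex τ (fun T => networkUtility Λ Λ p i (withIdent b T)) = θ := by
      rw [← ex_const τ θ]
      exact ex_congr_support fun T hT => hhonest T ((PMF.mem_support_iff _ _).2 hT) i
    have hsplit : ∀ f : PointedTopology → ℝ≥0∞, ex τ f =
        (∑' T : RootedTopology d, τ T.1 * f T.1) +
          ∑' T : ({T : PointedTopology | T.1.deg T.2 = d}ᶜ : Set PointedTopology), τ T.1 * f T.1 :=
      fun f => (ENNReal.summable.tsum_add_tsum_compl (f := fun T => τ T * f T)
        (s := {T : PointedTopology | T.1.deg T.2 = d}) ENNReal.summable).symm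
    -- Multiplying the average gain under the conditional law by the mass of degree d undoes the
    -- normalisation. Outside degree d both behaviours earn θ.
    have hin : (∑' T : RootedTopology d, τ T.1) * θ <
        ∑' T : RootedTopology d, τ T.1 * networkUtility Λ D p i (withIdent b T.1) := by
      have h2 : ex π u * ∑' T : RootedTopology d, τ T.1 =
          ∑' T : RootedTopology d, τ T.1 * networkUtility Λ D p i (withIdent b T.1) := by
        unfold ex
        rw [← ENNReal.tsum_mul_right]
        refine tsum_congr fun T => ?_
        rw [hπ, PMF.normalize_apply, hdev T i, mul_right_comm, mul_assoc (τ T.1),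
          ENNReal.inv_mul_cancel h0 htop, mul_one]
      rw [← h2, mul_comm]
      exact ENNReal.mul_lt_mul_left h0 htop hgain'
    have hout : (∑' T : ({T : PointedTopology | T.1.deg T.2 = d}ᶜ : Set PointedTopology),
          τ T.1 * networkUtility Λ D p i (withIdent b T.1)) =
        ∑' T : ({T : PointedTopology | T.1.deg T.2 = d}ᶜ : Set PointedTopology), τ T.1 * θ := by
      refine tsum_congr fun T => ?_
      by_cases hT : τ T.1 = 0
      · simp [hT]
      · rw [hother T.1 ((PMF.mem_support_iff _ _).2 hT) T.2 i]
    have htot := hsplit fun _ => θ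
    rw [ex_const, ENNReal.tsum_mul_right] at htot
    rw [h1, hsplit, hout]
    nth_rewrite 1 [htot]
    refine ENNReal.add_lt_add_right ?_ hin
    exact ne_top_of_le_ne_top hθtop (le_of_le_of_eq le_add_self htot.symm)
  -- An average above θ is above θ somewhere on its support, and `u` is independent of the own
  -- input.
  · obtain ⟨T, hT, hlt⟩ : ∃ T, π T ≠ 0 ∧ θ < u T := by
      by_contra hcon
      push Not at hcon
      exact absurd ((ex_mono_support hcon).trans (ex_const π θ).le) (not_le.2 hgain')
    have hT' : T.1 ∈ τ.support := by
      rw [PMF.mem_support_iff]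
      intro h
      rw [hπ, PMF.normalize_apply, h, zero_mul] at hT
      exact hT rfl
    refine ⟨withIdent b T.1, (PMF.mem_support_map_iff _ _ _).2 ⟨T.1, hT', rfl⟩, fun i => ?_⟩
    rw [hhonest T.1 hT' i, hdev]
    exact hlt

end Prior

end

end KnowledgeSharing

end

open KnowledgeSharing in
theorem mainTheorem1 {X M Y : Type} [Fintype X] [Nonempty X] [Fintype Y]
    (hk : 2 ≤ Fintype.card Y)
    (q : ∀ m : ℕ, (Fin m → X) → Y) (hq : FullKnowledge q)
    (σ : PMF ℕ) (hσ : InfiniteSupport σ)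
    (Λ : Strategy X M Y) (hΛ : SolvesKnowledgeSharing q σ Λ)
    (τ : PMF PointedTopology) (hτ : ∀ T ∈ τ.support, TwoConnected T.1.G)
    (hτσ : τ.map (fun T => T.1.n) = σ) (p : Y) :
    ∃ (B : PMF PointedNetwork) (ident₀ : ℕ),
      B.map PointedNetwork.topology = τ ∧
      (∀ N ∈ B.support, N.1.ident N.2 = ident₀) ∧
      ∃ D : Strategy X M Y,
        (∀ i : X, expectedUtility Λ Λ p i B < expectedUtility Λ D p i B) ∧
        ∃ N ∈ B.support, ∀ i : X, networkUtility Λ Λ p i N < networkUtility Λ D p i N := by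
  obtain ⟨n₀, hn₀⟩ := hσ
  -- Any topology of the support will do: it only fixes a degree of positive probability on which to
  -- condition.
  obtain ⟨T₀, hT₀⟩ := τ.support_nonempty
  have hsize : ∀ T ∈ τ.support, T.1.n ∈ σ.support := fun T hT => by
    rw [← hτσ]
    exact (PMF.mem_support_map_iff _ _ _).2 ⟨T, hT, rfl⟩
  have h0 : ∑' T : RootedTopology (T₀.1.deg T₀.2), τ T.1 ≠ 0 := fun h =>
    (PMF.mem_support_iff _ _).1 hT₀ (ENNReal.tsum_eq_zero.1 h ⟨T₀, rfl⟩)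
  have htop : ∑' T : RootedTopology (T₀.1.deg T₀.2), τ T.1 ≠ ⊤ := by
    refine ne_top_of_le_ne_top ENNReal.one_ne_top ?_
    rw [← τ.tsum_coe]
    exact ENNReal.tsum_comp_le_tsum_of_injective Subtype.val_injective _
  have hπ : ∀ T, PMF.normalize (fun T : RootedTopology (T₀.1.deg T₀.2) => τ T.1) h0 htop T ≠ 0 →
      TwoConnected T.1.1.G := fun T hT =>
    hτ T.1 ((PMF.mem_support_iff _ _).2 fun h => hT (by rw [PMF.normalize_apply, h, zero_mul]))
  have hcard : (2 : ENNReal) ≤ (Fintype.card Y : ENNReal) := by exact_mod_cast hk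
  have hθ : (Fintype.card Y : ENNReal)⁻¹ < 1 :=
    ENNReal.inv_lt_one.2 (lt_of_lt_of_le ENNReal.one_lt_two hcard)
  -- The cut with the profitable switch decides which half is the real network, hence which
  -- identifier family enters the prior.
  rcases (setting_halves (Classical.arbitrary X) hq hΛ hn₀ p hπ).exists_profitable_switch
    (by simp) hθ with ⟨c, z, t, h⟩ | ⟨c, z, t, h⟩
  · refine exists_prior_of_gain hq hΛ hτ hsize h0 htop true
      (((middle Λ _ (n₀ + 1) (Classical.arbitrary X)).attach
        (half Λ false (PMF.normalize (fun T : RootedTopology _ => τ T.1) h0 htop)).record).switch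
          c z)
      (switchOutput c fun z => Λ.out (z.1 (Sum.inr 0)))
      (switchOutput_of_step_ne_zero ?_) t (h.trans_eq ?_)
    · exact fun z m z' hz y hy =>
        middle_out_of_step_ne_zero (Classical.arbitrary X) _ (Party.attach_step_ne_zero hz).1 hy
    · refine congrArg _ (funext fun g => ?_)
      rw [← ind_and]
      refine ind_congr ?_
      rw [switchOutput_eq_some_iff]
      tauto
  · refine exists_prior_of_gain hq hΛ hτ hsize h0 htop false
      (((middle Λ _ (n₀ + 1) (Classical.arbitrary X)).swap.attach
        (half Λ true (PMF.normalize (fun T : RootedTopology _ => τ T.1) h0 htop)).record).switch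
          c z)
      (switchOutput c fun z => Λ.out (z.1 (Sum.inr 0)))
      (switchOutput_of_step_ne_zero ?_) t (h.trans_eq ?_)
    · exact fun z m z' hz y hy =>
        middle_out_of_step_ne_zero (Classical.arbitrary X) _ (Party.attach_step_ne_zero hz).1 hy
    · refine congrArg _ (funext fun g => ?_)
      rw [← ind_and]
      refine ind_congr ?_
      rw [switchOutput_eq_some_iff]
      tauto
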